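/- **Setting.** Let $\mathcal H_K,\mathcal H_L$ be real Hilbert spaces and let $P_K,Q_L$ be Borel probability measures on $\mathcal H_K$ and $\mathcal H_L$. Let $\mathcal C_{KK}=\mathbb E_{u\sim P_K}u\otimes u$ and $\mathcal C_{Q_L}=\mathbb E_{v\sim Q_L}v\otimes v$ be the (uncentered) covariance operators, with orthonormal eigenbases $(\hat e_i)_{i\ge1}$ of $\mathcal H_K$ and $(\hat f_j)_{j\ge1}$ of $\mathcal H_L$ and eigenvalues $\mu_i$, $\rho_j$. For a possibly unbounded linear operator $T$ from $\mathcal H_K$ to $\mathcal H_L$ put $$\|T\|_{\beta,\gamma}=\big\|\mathcal C_{Q_L}^{-(1-\gamma)/2}\,T\,\mathcal C_{KK}^{(1-\beta)/2}\big\|_{\mathrm{HS}(\mathcal H_K,\mathcal H_L)}\in[0,\infty],$$ with value $\infty$ if $\mathcal C_{Q_L}^{-(1-\gamma)/2}T\mathcal C_{KK}^{(1-\beta)/2}$ is not an everywhere defined Hilbert--Schmidt operator. **Assumptions.** (1) *Eigenvalue decay:* $\mu_i\asymp i^{-1/p}$ and $\rho_j\asymp j^{-1/q}$ for some $p,q\in(0,1)$.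 (2) *Input embedding:* for some $\alpha\in(0,1)$ and $A_1<\infty$, $\|\mathcal C_{KK}^{-(1-\alpha)/2}u\|_{\mathcal H_K}\le A_1$ for $P_K$-almost every $u$. Let $0\le\beta'<\beta\le1$ and $0\le\gamma<\gamma'\le1$, and let $A_2,\sigma,R,B>0$. **Theorem.** There is a constant $c>0$, depending only on the data fixed above, such that for every $N\ge1$ and every estimator $\mathcal L$, that is, every map that assigns to $N$ data points in $\mathcal H_K\times\mathcal H_L$ a possibly unbounded linear operator from $\mathcal H_K$ to $\mathcal H_L$ (in particular every estimator whose values have finite $(\beta,\gamma)$-norm), there exist a bounded linear operator $\mathcal A_0:\mathcal H_K\to\mathcal H_L$ and a probability distribution $P_{KL}$ on $\mathcal H_K\times\mathcal H_L$ with first marginal $P_K$ and a regular conditional distribution $P_{KL}(\cdot\mid u)$ with $\mathbb E_{v\sim P_{KL}(\cdot\mid u)}v=\mathcal A_0u$ for all $u\in\mathrm{supp}(P_K)$, satisfying - *output boundedness:* $\|\mathcal A_0u\|_{\mathcal H_L}\le A_2$ for $P_K$-almost every $u$; - *moment condition:* there is a positive operator $V$ on $\mathcal H_L$ with $\operatorname{tr}V\le\sigma^2$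 such that $\mathbb E_{v\sim P_{KL}(\cdot\mid u)}\big[\big((v-\mathcal A_0u)\otimes(v-\mathcal A_0u)\big)^k\big]\preceq\frac12(2k)!\,R^{2k-2}V$ for all $u\in\mathrm{supp}(P_K)$ and all integers $k\ge2$; - *source condition:* $\|\mathcal A_0\|_{\beta,\gamma}\le B$; such that, with probability at least $0.99$ over i.i.d. $(u_1,v_1),\dots,(u_N,v_N)\sim P_{KL}$, $$\big\|\mathcal L\big(\{(u_i,v_i)\}_{i=1}^N\big)-\mathcal A_0\big\|_{\beta',\gamma'}^2\ \ge\ c\,N^{-\min\left\{\frac{\max\{\alpha,\beta\}-\beta'}{\max\{\alpha,\beta\}+p},\ \frac{\gamma'-\gamma}{1-\gamma}\right\}} .$$ (If the event is not measurable, its probability is understood as outer probability.) -/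

import Mathlib

open MeasureTheory ProbabilityTheory
open scoped ENNReal

noncomputable section

namespace OperatorLearning

variable {H : Type*} [NormedAddCommGroup H] [InnerProductSpace ℝ H] [CompleteSpace H]
  [MeasurableSpace H] [BorelSpace H]
variable {HK HL : Type*}
  [NormedAddCommGroup HK] [InnerProductSpace ℝ HK] [CompleteSpace HK]
  [MeasurableSpace HK] [BorelSpace HK]
  [NormedAddCommGroup HL] [InnerProductSpace ℝ HL] [CompleteSpace HL]
  [MeasurableSpace HL] [BorelSpace HL]

/-- The tensor `g ⊗ g : x ↦ ⟪g, x⟫ g`. -/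
def selfTensor (g : H) : H →L[ℝ] H := InnerProductSpace.rankOne ℝ g g

/-- The uncentered covariance operator `E_{u ∼ P} u ⊗ u` (a Bochner integral of operators).
If `u ⊗ u` is not integrable this is `0`, which `IsEigenSystem` together with
`PolynomialDecay` rules out. -/
def covOp (P : Measure H) : H →L[ℝ] H := ∫ u, selfTensor u ∂P

/-- `b` is an orthonormal eigenbasis of the covariance operator of `P`, with eigenvalues `ev`. -/
def IsEigenSystem (P : Measure H) (b : HilbertBasis ℕ ℝ H) (ev : ℕ → ℝ) : Prop :=
  ∀ i, covOp P (b i) = ev i • b i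

/-- The eigenvalues satisfy `ev i ≍ i ^ (-1/p)`; the index is shifted since it starts at `0`. -/
def PolynomialDecay (ev : ℕ → ℝ) (p : ℝ) : Prop :=
  ∃ c C : ℝ, 0 < c ∧ 0 < C ∧
    ∀ i : ℕ, c * ((i : ℝ) + 1) ^ (-(1 / p)) ≤ ev i ∧ ev i ≤ C * ((i : ℝ) + 1) ^ (-(1 / p))

/-- The power `𝒞 ^ s` (for `s ≥ 0`) of the operator `𝒞` that is diagonal in the orthonormal basis
`b` with (bounded, positive) eigenvalues `ev`. -/
def specPow (b : HilbertBasis ℕ ℝ H) (ev : ℕ → ℝ) (s : ℝ) (x : H) : H :=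
  ∑' i, (ev i ^ s * inner ℝ (b i) x) • b i

/-- The squared Hilbert-Schmidt norm, in `[0, ∞]`. -/
def hsNormSq (b : HilbertBasis ℕ ℝ HK) (S : HK →L[ℝ] HL) : ℝ≥0∞ :=
  ∑' i, ‖S (b i)‖ₑ ^ 2

/-- The squared `(β, γ)`-norm `‖𝒞_L ^ (-(1-γ)/2) ∘ T ∘ 𝒞_K ^ ((1-β)/2)‖²_HS` of a possibly
unbounded linear operator `T`, where `𝒞_K` has eigensystem `(e, μ)` and `𝒞_L` has eigensystem
`(f, ρ)`. The composition is the operator `S` with `T ∘ 𝒞_K ^ ((1-β)/2) = 𝒞_L ^ ((1-γ)/2) ∘ S`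
(unique if all `ρ j > 0`); if no such bounded `S` exists, the value is `∞`. -/
def bgNormSq (e : HilbertBasis ℕ ℝ HK) (μ : ℕ → ℝ) (f : HilbertBasis ℕ ℝ HL) (ρ : ℕ → ℝ)
    (β γ : ℝ) (T : HK →ₗ.[ℝ] HL) : ℝ≥0∞ :=
  ⨅ (S : HK →L[ℝ] HL)
    (_ : ∀ x : HK, ∃ hx : specPow e μ ((1 - β) / 2) x ∈ T.domain,
      T ⟨specPow e μ ((1 - β) / 2) x, hx⟩ = specPow f ρ ((1 - γ) / 2) (S x)),
    hsNormSq e S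

/-- A bounded operator, seen as an everywhere defined member of the class of possibly unbounded
operators. -/
def ofCLM (A : HK →L[ℝ] HL) : HK →ₗ.[ℝ] HL := A.toLinearMap.toPMap ⊤

/-- Embedding property of the input space: almost surely
`‖𝒞_K ^ (-(1-α)/2) u‖ ≤ A₁`. -/
def InputEmbedding (PK : Measure HK) (e : HilbertBasis ℕ ℝ HK) (μ : ℕ → ℝ) (α A₁ : ℝ) : Prop :=
  ∀ᵐ u ∂PK, ∃ w : HK, specPow e μ ((1 - α) / 2) w = u ∧ ‖w‖ ≤ A₁

/-- Regression model `v = A₀ u + ε` with `E[ε ∣ u] = 0`: the joint law `PKL` has first marginal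
`PK` and `κ u` is the conditional law of `v` given `u`. -/
structure IsDataModel (PK : Measure HK) (PKL : Measure (HK × HL)) (κ : Kernel HK HL)
    (A₀ : HK →L[ℝ] HL) : Prop where
  isProbability : IsProbabilityMeasure PKL
  isMarkov : IsMarkovKernel κ
  marginal : PKL.fst = PK
  disintegration : PKL = PK ⊗ₘ κ
  integrable : ∀ u ∈ PK.support, Integrable (fun v => v) (κ u)
  condMean : ∀ u ∈ PK.support, ∫ v, v ∂(κ u) = A₀ u

/-- Boundedness of the outputs: `‖A₀ u‖ ≤ A₂` for `PK`-almost all `u`. -/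
def OutputBounded (PK : Measure HK) (A₀ : HK →L[ℝ] HL) (A₂ : ℝ) : Prop :=
  ∀ᵐ u ∂PK, ‖A₀ u‖ ≤ A₂

/-- Moment condition on the noise: for some positive operator `V` of trace at most `σ²`,
`E[((v - A₀ u) ⊗ (v - A₀ u)) ^ k ∣ u] ≼ (1/2) (2k)! R^(2k-2) V` for all `u` in the support of `PK`
and all `k ≥ 2`. The trace is computed in the orthonormal basis `f`. -/
def MomentCondition (PK : Measure HK) (κ : Kernel HK HL) (A₀ : HK →L[ℝ] HL)
    (f : HilbertBasis ℕ ℝ HL) (σ R : ℝ) : Prop :=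
  ∃ V : HL →L[ℝ] HL, V.IsPositive ∧
    ∑' j, ENNReal.ofReal (inner ℝ (V (f j)) (f j)) ≤ ENNReal.ofReal (σ ^ 2) ∧
    ∀ u ∈ PK.support, ∀ k : ℕ, 2 ≤ k →
      Integrable (fun v => selfTensor (v - A₀ u) ^ k) (κ u) ∧
      ((((1 : ℝ) / 2 * (Nat.factorial (2 * k) : ℝ) * R ^ (2 * k - 2)) • V)
        - ∫ v, selfTensor (v - A₀ u) ^ k ∂(κ u)).IsPositive

/-- Source condition `‖A₀‖_{β,γ} ≤ B`. -/
def SourceCondition (e : HilbertBasis ℕ ℝ HK) (μ : ℕ → ℝ) (f : HilbertBasis ℕ ℝ HL) (ρ : ℕ → ℝ)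
    (β γ : ℝ) (A₀ : HK →L[ℝ] HL) (B : ℝ) : Prop :=
  bgNormSq e μ f ρ β γ (ofCLM A₀) ≤ ENNReal.ofReal (B ^ 2)

end OperatorLearning

end

noncomputable section

namespace OperatorLearning

/-! The bound comes from testing `2 ^ n` rank-one hypotheses at once. Fix an output direction `f j`,
a block `I` of `n` input directions and an amplitude `a`. A subset `S ⊆ I` gives the operator `A_S u
= a ∑_{k ∈ S} ⟪e k, u⟫ f j`, and `v` is a random sign `± τ f j` biased to have mean `A_S u`.

Testing: against the unbiased sign law `Q`, Cauchy–Schwarz gives `P_S(G)² ≤ Λ Q(G)` on `N` samples,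
with `Λ = exp (n / 20)` as soon as `N a² ∑_{k ∈ I} μ k ≤ τ² n / 20`
(`sq_pi_compProd_signKernel_le`). An estimate within the target radius of both `A_S` and `A_T`
forces `S` and `T` to differ in at most `n / 8` places (`sum_sq_inner_le_of_bgNormSq_lt`), so one
data set accepts at most `(3 / 2) ^ n` hypotheses (`card_hammingBall_le`). If every hypothesis were
accepted with probability above `0.01`, summing over `S` would give `2 ^ n ≤ 10000 exp (n / 20) (3 /
2) ^ n`, false for `n ≥ 64` (`exists_le_measure_compl`, `card_testing_bound`). All subsets are used,
with no separated subfamily.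

Calibration: with `s = max α β`, `I = [d, 2d)` and `m = d ^ (-1/p)`, the choice `a² ≍ ρ j ^ (1-γ) m
^ (s-1) / d` respects the output and source bounds and separates at the level `ρ j ^ (γ'-γ) m ^
(s-β')`, provided `N ρ j ^ (1-γ) m ^ s ≲ d` (`exists_hasHardInstance`). Fixing `j` and growing `d`
gives the first exponent of the minimum; fixing `d` and growing `j` gives the second. -/

/-! ### Likelihood ratios on product spaces and testing of many hypotheses -/

theorem lintegral_pi_prod {ι X : Type*} [Fintype ι] [MeasurableSpace X] (P : Measure X)
    [IsProbabilityMeasure P] (g : ι → X → ℝ≥0∞) (hg : ∀ i, Measurable (g i)) :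
    ∫⁻ x, ∏ i, g i (x i) ∂Measure.pi (fun _ : ι => P) = ∏ i, ∫⁻ x, g i x ∂P := by
  have hind : iIndepFun (fun i (x : ι → X) => g i (x i)) (Measure.pi (fun _ : ι => P)) :=
    iIndepFun_pi (X := g) fun i => (hg i).aemeasurable
  have h := lintegral_prod_eq_prod_lintegral_of_indepFun Finset.univ _ hind
    fun i => (hg i).comp (measurable_pi_apply i)
  rw [h]
  refine Finset.prod_congr rfl fun i _ => ?_
  exact (measurePreserving_eval (fun _ : ι => P) i).lintegral_comp (hg i)

theorem pi_withDensity {ι X : Type*} [Fintype ι] [MeasurableSpace X] (P : Measure X)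
    [IsProbabilityMeasure P] (f : X → ℝ≥0∞) (hf : Measurable f)
    [IsProbabilityMeasure (P.withDensity f)] :
    Measure.pi (fun _ : ι => P.withDensity f)
      = (Measure.pi (fun _ : ι => P)).withDensity (fun x => ∏ i, f (x i)) := by
  symm
  refine (Measure.pi_eq fun s hs => ?_).symm
  rw [withDensity_apply _ (MeasurableSet.univ_pi hs), ← lintegral_indicator (.univ_pi hs)]
  have : (Set.univ.pi s).indicator (fun x : ι → X => ∏ i, f (x i))
      = fun x => ∏ i, (s i).indicator f (x i) := by
    ext x
    by_cases hx : x ∈ Set.univ.pi s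
    · rw [Set.indicator_of_mem hx]
      exact Finset.prod_congr rfl fun i _ => (Set.indicator_of_mem (hx i trivial) f).symm
    · rw [Set.indicator_of_notMem hx]
      simp only [Set.mem_pi, Set.mem_univ, true_implies, not_forall] at hx
      obtain ⟨i, hi⟩ := hx
      exact (Finset.prod_eq_zero (Finset.mem_univ i) (Set.indicator_of_notMem hi f)).symm
  rw [this, lintegral_pi_prod P (fun i => (s i).indicator f) fun i => hf.indicator (hs i)]
  refine Finset.prod_congr rfl fun i _ => ?_
  rw [lintegral_indicator (hs i), withDensity_apply _ (hs i)]

/-- Cauchy–Schwarz for the product density against the indicator of `G`; the second moment of the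
density tensorizes. -/
theorem sq_pi_withDensity_le {ι X : Type*} [Fintype ι] [MeasurableSpace X] (P : Measure X)
    [IsProbabilityMeasure P] (f : X → ℝ≥0∞) (hf : Measurable f)
    [IsProbabilityMeasure (P.withDensity f)] {G : Set (ι → X)} (hG : MeasurableSet G) :
    (Measure.pi (fun _ : ι => P.withDensity f) G) ^ 2
      ≤ (∫⁻ x, f x ^ 2 ∂P) ^ Fintype.card ι * Measure.pi (fun _ : ι => P) G := by
  set Q := Measure.pi (fun _ : ι => P)
  have hF : Measurable fun x : ι → X => ∏ i, f (x i) :=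
    Finset.measurable_fun_prod _ fun i _ => hf.comp (measurable_pi_apply i)
  have hcs := ENNReal.lintegral_mul_le_Lp_mul_Lq Q Real.HolderConjugate.two_two
    hF.aemeasurable ((measurable_const (a := (1 : ℝ≥0∞))).indicator hG).aemeasurable
  have h1 : Measure.pi (fun _ : ι => P.withDensity f) G
      = ∫⁻ x, ((fun x : ι → X => ∏ i, f (x i)) * G.indicator fun _ => (1 : ℝ≥0∞)) x ∂Q := by
    rw [pi_withDensity P f hf, withDensity_apply _ hG, ← lintegral_indicator hG]
    refine lintegral_congr fun x => ?_
    by_cases hx : x ∈ G <;> simp [hx]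
  have h2 : ∫⁻ x, (∏ i, f (x i)) ^ (2 : ℝ) ∂Q = (∫⁻ x, f x ^ 2 ∂P) ^ Fintype.card ι := by
    have := lintegral_pi_prod P (fun _ : ι => fun x => f x ^ 2) fun _ => hf.pow_const 2
    simp only [Finset.prod_const, Finset.card_univ] at this
    rw [← this]
    refine lintegral_congr fun x => ?_
    rw [ENNReal.rpow_two, Finset.prod_pow]
  have h3 : ∫⁻ x, (G.indicator (fun _ => (1 : ℝ≥0∞)) x) ^ (2 : ℝ) ∂Q = Q G := by
    rw [← lintegral_indicator_one hG]
    refine lintegral_congr fun x => ?_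
    by_cases hx : x ∈ G <;> simp [hx]
  rw [h1, ← h2, ← h3]
  refine (pow_le_pow_left' hcs 2).trans_eq ?_
  rw [mul_pow, ← ENNReal.rpow_two, ← ENNReal.rpow_two, ← ENNReal.rpow_mul, ← ENNReal.rpow_mul]
  norm_num

/-- Lower bound for testing many hypotheses `P m` whose squared likelihood ratios with respect to
`Q` are bounded by `Λ`, if no outcome is accepted by more than `K` of the acceptance regions `E m`.
The regions need not be measurable. -/
theorem exists_le_measure_compl {Ω ι : Type*} [MeasurableSpace Ω] (J : Finset ι)
    (Q : Measure Ω) [IsProbabilityMeasure Q] (P : ι → Measure Ω)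
    (hP : ∀ m ∈ J, IsProbabilityMeasure (P m)) (Λ K : ℝ) (hΛ : 0 ≤ Λ) (hK : 0 ≤ K)
    (hPQ : ∀ m ∈ J, ∀ G, MeasurableSet G → P m G ^ 2 ≤ ENNReal.ofReal Λ * Q G)
    (E : ι → Set Ω)
    (hE : ∀ J' ⊆ J, ∀ x, (∀ m ∈ J', x ∈ E m) → (J'.card : ℝ) ≤ K)
    (hcard : 10000 * (Λ * K) < J.card) :
    ∃ m ∈ J, ENNReal.ofReal 0.99 ≤ P m (E m)ᶜ := by
  classical
  by_contra! hcon
  -- A measurable subset of `E m` whose complement has the same outer measure as that of `E m`.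
  let G : ι → Set Ω := fun m => (toMeasurable (P m) (E m)ᶜ)ᶜ
  have hGm : ∀ m, MeasurableSet (G m) := fun m => (measurableSet_toMeasurable _ _).compl
  have hGE : ∀ m, G m ⊆ E m := fun m => by
    rw [← Set.compl_subset_compl, compl_compl]; exact subset_toMeasurable _ _
  have hGP : ∀ m ∈ J, ENNReal.ofReal 0.01 ≤ P m (G m) := fun m hm => by
    have := hP m hm
    rw [prob_compl_eq_one_sub (measurableSet_toMeasurable _ _), measure_toMeasurable]
    refine le_trans ?_ (tsub_le_tsub_left (hcon m hm).le 1)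
    rw [← ENNReal.ofReal_one, ← ENNReal.ofReal_sub _ (by norm_num)]
    exact ENNReal.ofReal_le_ofReal (by norm_num)
  -- The factor `10000` is `0.01⁻²`: the change of measure squares the acceptance probability.
  have hGQ : ∀ m ∈ J, ENNReal.ofReal 0.0001 ≤ ENNReal.ofReal Λ * Q (G m) := fun m hm => by
    refine le_trans ?_ (hPQ m hm _ (hGm m))
    refine le_trans ?_ (pow_le_pow_left' (hGP m hm) 2)
    rw [← ENNReal.ofReal_pow (by norm_num)]
    exact ENNReal.ofReal_le_ofReal (by norm_num)
  have hsum : ∑ m ∈ J, Q (G m) ≤ ENNReal.ofReal K := by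
    have : ∑ m ∈ J, Q (G m) = ∫⁻ x, ∑ m ∈ J, (G m).indicator 1 x ∂Q := by
      rw [lintegral_finsetSum _ fun m _ => measurable_one.indicator (hGm m)]
      exact Finset.sum_congr rfl fun m _ => (lintegral_indicator_one (hGm m)).symm
    rw [this]
    refine (lintegral_mono (g := fun _ => ENNReal.ofReal K) fun x => ?_).trans (by simp)
    have h := hE (J.filter fun m => x ∈ G m) (Finset.filter_subset _ _) x
      fun m hm => hGE m (Finset.mem_filter.1 hm).2
    have h' : ∑ m ∈ J, (G m).indicator (1 : Ω → ℝ≥0∞) x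
        = ((J.filter fun m => x ∈ G m).card : ℝ≥0∞) := by
      simp only [Set.indicator_apply, Pi.one_apply]
      rw [Finset.sum_boole]
    rw [h', ← ENNReal.ofReal_natCast]
    exact ENNReal.ofReal_le_ofReal h
  have htot : ENNReal.ofReal (J.card * 0.0001) ≤ ENNReal.ofReal (Λ * K) := by
    calc ENNReal.ofReal (J.card * 0.0001) = ∑ m ∈ J, ENNReal.ofReal 0.0001 := by
          rw [Finset.sum_const, nsmul_eq_mul, ENNReal.ofReal_mul (by positivity),
            ENNReal.ofReal_natCast]
      _ ≤ ∑ m ∈ J, ENNReal.ofReal Λ * Q (G m) := Finset.sum_le_sum hGQ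
      _ = ENNReal.ofReal Λ * ∑ m ∈ J, Q (G m) := by rw [Finset.mul_sum]
      _ ≤ ENNReal.ofReal Λ * ENNReal.ofReal K := by gcongr
      _ = _ := (ENNReal.ofReal_mul hΛ).symm
  rw [ENNReal.ofReal_le_ofReal_iff (mul_nonneg hΛ hK)] at htot
  linarith

/-- Volume of Hamming balls of relative radius `1/8`. -/
theorem card_hammingBall_le {ι : Type*} [DecidableEq ι] (I : Finset ι) {S : Finset ι} (hS : S ⊆ I)
    (J : Finset (Finset ι)) (hJ : J ⊆ I.powerset)
    (h : ∀ T ∈ J, 8 * (symmDiff S T).card ≤ I.card) :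
    (J.card : ℝ) ≤ (3 / 2) ^ I.card := by
  -- Chernoff argument: each `T` in the ball has weight `t ^ (8 |S ∆ T|) ≥ t ^ n`, while the total
  -- weight over all subsets is `(1 + t ^ 8) ^ n`. The value `4 / 5` gives `1 + t ^ 8 ≤ (3 / 2) t`.
  set t : ℝ := 4 / 5
  have hsum : ∑ T ∈ I.powerset, (t ^ 8) ^ (symmDiff S T).card = (t ^ 8 + 1) ^ I.card := by
    rw [← Finset.sum_pow_mul_eq_add_pow]
    refine Finset.sum_nbij' (symmDiff S) (symmDiff S) ?_ ?_ ?_ ?_ ?_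
    · intro T hT
      rw [Finset.mem_powerset] at hT ⊢
      exact symmDiff_le_sup.trans (Finset.union_subset hS hT)
    · intro T hT
      rw [Finset.mem_powerset] at hT ⊢
      exact symmDiff_le_sup.trans (Finset.union_subset hS hT)
    · intro T _; exact symmDiff_symmDiff_cancel_left S T
    · intro T _; exact symmDiff_symmDiff_cancel_left S T
    · intro T _; simp
  have h1 : (J.card : ℝ) * t ^ I.card ≤ (t ^ 8 + 1) ^ I.card := by
    rw [← hsum, ← nsmul_eq_mul, ← Finset.sum_const]
    refine (Finset.sum_le_sum fun T hT => ?_).trans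
      (Finset.sum_le_sum_of_subset_of_nonneg hJ fun T _ _ => by positivity)
    rw [← pow_mul]
    exact pow_le_pow_of_le_one (by norm_num [t]) (by norm_num [t]) (h T hT)
  have h2 : (t ^ 8 + 1) ^ I.card ≤ (3 / 2 * t) ^ I.card :=
    pow_le_pow_left₀ (by positivity) (by norm_num [t]) _
  have h3 := h1.trans h2
  rw [mul_pow] at h3
  exact le_of_mul_le_mul_right h3 (by positivity)

/-! ### Diagonal operators, `(β, γ)`-norms and the rank-one hypotheses -/

section Spectral

variable {H : Type*} [NormedAddCommGroup H] [InnerProductSpace ℝ H]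
variable {HK HL : Type*} [NormedAddCommGroup HK] [InnerProductSpace ℝ HK]
  [NormedAddCommGroup HL] [InnerProductSpace ℝ HL]

/-- Bounded multipliers keep the coefficients square summable, so the `tsum` in `specPow` is a
genuine sum and not the default value. -/
theorem inner_specPow (b : HilbertBasis ℕ ℝ H) {ev : ℕ → ℝ} {s C : ℝ} (h0 : ∀ i, 0 < ev i)
    (hC : ∀ i, ev i ≤ C) (hs : 0 ≤ s) (x : H) (j : ℕ) :
    inner ℝ (b j) (specPow b ev s x) = ev j ^ s * inner ℝ (b j) x := by
  have hmem : Memℓp (fun i => ev i ^ s * inner ℝ (b i) x) 2 := by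
    have hx : Memℓp (fun i => C ^ s * b.repr x i) 2 := (lp.memℓp (b.repr x)).const_mul (C ^ s)
    refine memℓp_gen ?_
    have hx' := hx.summable (by norm_num)
    refine Summable.of_nonneg_of_le (fun i => by positivity) (fun i => ?_) hx'
    refine Real.rpow_le_rpow (norm_nonneg _) ?_ (by norm_num)
    rw [norm_mul, norm_mul, HilbertBasis.repr_apply_apply]
    refine mul_le_mul_of_nonneg_right ?_ (norm_nonneg _)
    rw [Real.norm_of_nonneg (Real.rpow_nonneg (h0 i).le _),
      Real.norm_of_nonneg (Real.rpow_nonneg ((h0 i).le.trans (hC i)) _)]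
    exact Real.rpow_le_rpow (h0 i).le (hC i) hs
  have hsum := b.hasSum_repr_symm (⟨_, hmem⟩ : lp (fun _ : ℕ => ℝ) 2)
  have heq : specPow b ev s x = b.repr.symm (⟨_, hmem⟩ : lp (fun _ : ℕ => ℝ) 2) := hsum.tsum_eq
  rw [heq, ← HilbertBasis.repr_apply_apply, LinearIsometryEquiv.apply_symm_apply]

theorem ext_inner_hilbertBasis {b : HilbertBasis ℕ ℝ H} {x y : H}
    (h : ∀ i, inner ℝ (b i) x = inner ℝ (b i) y) : x = y := by
  apply b.repr.injective
  ext i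
  rw [HilbertBasis.repr_apply_apply, HilbertBasis.repr_apply_apply, h i]

theorem inner_hilbertBasis (b : HilbertBasis ℕ ℝ H) (i j : ℕ) :
    inner ℝ (b i) (b j) = if i = j then (1 : ℝ) else 0 :=
  orthonormal_iff_ite.1 b.orthonormal i j

theorem specPow_smul_basis (b : HilbertBasis ℕ ℝ H) {ev : ℕ → ℝ} {s C : ℝ} (h0 : ∀ i, 0 < ev i)
    (hC : ∀ i, ev i ≤ C) (hs : 0 ≤ s) (t : ℝ) (j : ℕ) :
    specPow b ev s (t • b j) = (ev j ^ s * t) • b j := by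
  refine ext_inner_hilbertBasis (b := b) fun i => ?_
  rw [inner_specPow b h0 hC hs, inner_smul_right, inner_smul_right, inner_hilbertBasis]
  by_cases h : i = j
  · subst h; simp
  · simp [h]

theorem sum_norm_sq_le_of_hsNormSq_lt {e : HilbertBasis ℕ ℝ HK} {S : HK →L[ℝ] HL} {r : ℝ}
    (hr : 0 ≤ r) (h : hsNormSq e S < ENNReal.ofReal r) (F : Finset ℕ) :
    ∑ i ∈ F, ‖S (e i)‖ ^ 2 ≤ r := by
  rw [← ENNReal.ofReal_le_ofReal_iff hr, ENNReal.ofReal_sum_of_nonneg fun i _ => by positivity]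
  refine le_trans ?_ h.le
  refine le_trans (le_of_eq ?_) (ENNReal.sum_le_tsum F)
  refine Finset.sum_congr rfl fun i _ => ?_
  rw [ENNReal.ofReal_pow (norm_nonneg _), ofReal_norm]

/-- Two bounded operators that are both `(β, γ)`-close to the same possibly unbounded operator are
close to each other along a fixed output direction. -/
theorem sum_sq_inner_le_of_bgNormSq_lt (e : HilbertBasis ℕ ℝ HK) {μ : ℕ → ℝ}
    (f : HilbertBasis ℕ ℝ HL) {ρ : ℕ → ℝ} {Cμ Cρ β γ r : ℝ}
    (hμ0 : ∀ i, 0 < μ i) (hμC : ∀ i, μ i ≤ Cμ) (hρ0 : ∀ i, 0 < ρ i) (hρC : ∀ i, ρ i ≤ Cρ)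
    (hβ : β ≤ 1) (hγ : γ ≤ 1) (hr : 0 ≤ r) (T : HK →ₗ.[ℝ] HL) (A A' : HK →L[ℝ] HL)
    (h : bgNormSq e μ f ρ β γ (T - ofCLM A) < ENNReal.ofReal r)
    (h' : bgNormSq e μ f ρ β γ (T - ofCLM A') < ENNReal.ofReal r) (j : ℕ) (F : Finset ℕ) :
    ∑ i ∈ F, μ i ^ (1 - β) * ρ j ^ (-(1 - γ)) * inner ℝ (f j) (A' (e i) - A (e i)) ^ 2
      ≤ 4 * r := by
  simp only [bgNormSq, iInf_lt_iff] at h h'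
  obtain ⟨S, hS, hSr⟩ := h
  obtain ⟨S', hS', hSr'⟩ := h'
  have hβ2 : 0 ≤ (1 - β) / 2 := by linarith
  have hγ2 : 0 ≤ (1 - γ) / 2 := by linarith
  have key : ∀ i, μ i ^ ((1 - β) / 2) * inner ℝ (f j) (A' (e i) - A (e i))
      = ρ j ^ ((1 - γ) / 2) * inner ℝ (f j) (S (e i) - S' (e i)) := fun i => by
    obtain ⟨hx, h1⟩ := hS (e i)
    obtain ⟨hx', h2⟩ := hS' (e i)
    rw [LinearPMap.sub_apply] at h1 h2
    have h3 := congrArg (inner ℝ (f j)) h1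
    have h4 := congrArg (inner ℝ (f j)) h2
    have hbas : specPow e μ ((1 - β) / 2) (e i) = μ i ^ ((1 - β) / 2) • e i := by
      simpa using specPow_smul_basis e hμ0 hμC hβ2 1 i
    rw [inner_specPow f hρ0 hρC hγ2, inner_sub_right] at h3 h4
    have hA : ∀ (B : HK →L[ℝ] HL) (z : (ofCLM B).domain),
        (z : HK) = specPow e μ ((1 - β) / 2) (e i) →
        inner ℝ (f j) ((ofCLM B) z) = μ i ^ ((1 - β) / 2) * inner ℝ (f j) (B (e i)) := by
      intro B z hz
      have : (ofCLM B) z = B z := rfl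
      rw [this, hz, hbas, map_smul, inner_smul_right]
    rw [hA A _ rfl] at h3
    rw [hA A' _ rfl] at h4
    rw [inner_sub_right, inner_sub_right]
    -- Both differences are evaluated at the same point of the domain of `T`, so the unknown value
    -- of `T` cancels.
    linear_combination h3 - h4
  have hterm : ∀ i, μ i ^ (1 - β) * ρ j ^ (-(1 - γ)) * inner ℝ (f j) (A' (e i) - A (e i)) ^ 2
      ≤ 2 * ‖S (e i)‖ ^ 2 + 2 * ‖S' (e i)‖ ^ 2 := fun i => by
    have hm : μ i ^ (1 - β) = (μ i ^ ((1 - β) / 2)) ^ 2 := by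
      rw [← Real.rpow_natCast, ← Real.rpow_mul (hμ0 i).le]; congr 1; push_cast; ring
    have hρ : ρ j ^ (-(1 - γ)) * (ρ j ^ ((1 - γ) / 2)) ^ 2 = 1 := by
      rw [← Real.rpow_natCast, ← Real.rpow_mul (hρ0 j).le, ← Real.rpow_add (hρ0 j)]
      convert Real.rpow_zero (ρ j) using 2; push_cast; ring
    have h1 : μ i ^ (1 - β) * ρ j ^ (-(1 - γ)) * inner ℝ (f j) (A' (e i) - A (e i)) ^ 2
        = inner ℝ (f j) (S (e i) - S' (e i)) ^ 2 := by
      rw [hm]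
      linear_combination (ρ j ^ (-(1 - γ))) *
        (μ i ^ ((1 - β) / 2) * inner ℝ (f j) (A' (e i) - A (e i))
          + ρ j ^ ((1 - γ) / 2) * inner ℝ (f j) (S (e i) - S' (e i))) * key i
        + inner ℝ (f j) (S (e i) - S' (e i)) ^ 2 * hρ
    rw [h1]
    have h2 : |inner ℝ (f j) (S (e i) - S' (e i))| ≤ ‖S (e i)‖ + ‖S' (e i)‖ := by
      refine (abs_real_inner_le_norm _ _).trans ?_
      rw [f.orthonormal.1 j, one_mul]
      exact norm_sub_le _ _
    have h3 := sq_le_sq' (by linarith [neg_abs_le (inner ℝ (f j) (S (e i) - S' (e i)))])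
      ((le_abs_self _).trans h2)
    nlinarith [sq_nonneg (‖S (e i)‖ - ‖S' (e i)‖)]
  refine (Finset.sum_le_sum fun i _ => hterm i).trans ?_
  rw [Finset.sum_add_distrib, ← Finset.mul_sum, ← Finset.mul_sum]
  linarith [sum_norm_sq_le_of_hsNormSq_lt hr hSr F, sum_norm_sq_le_of_hsNormSq_lt hr hSr' F]

/-- The direction in input space seen by the operator `blockOp`. -/
def blockVec (e : HilbertBasis ℕ ℝ HK) (a : ℝ) (S : Finset ℕ) : HK := ∑ k ∈ S, a • e k

/-- The operator `u ↦ a ∑_{k ∈ S} ⟪e k, u⟫ f j`. -/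
def blockOp (e : HilbertBasis ℕ ℝ HK) (f : HilbertBasis ℕ ℝ HL) (j : ℕ) (a : ℝ)
    (S : Finset ℕ) : HK →L[ℝ] HL :=
  InnerProductSpace.rankOne ℝ (f j) (blockVec e a S)

theorem blockOp_apply (e : HilbertBasis ℕ ℝ HK) (f : HilbertBasis ℕ ℝ HL) (j : ℕ) (a : ℝ)
    (S : Finset ℕ) (u : HK) : blockOp e f j a S u = inner ℝ (blockVec e a S) u • f j := by
  simp [blockOp]

theorem inner_blockVec (e : HilbertBasis ℕ ℝ HK) (a : ℝ) (S : Finset ℕ) (u : HK) :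
    inner ℝ (blockVec e a S) u = a * ∑ k ∈ S, inner ℝ (e k) u := by
  simp [blockVec, sum_inner, inner_smul_left, Finset.mul_sum]

theorem inner_blockVec_basis (e : HilbertBasis ℕ ℝ HK) (a : ℝ) (S : Finset ℕ) (i : ℕ) :
    inner ℝ (blockVec e a S) (e i) = if i ∈ S then a else 0 := by
  rw [inner_blockVec]
  simp [inner_hilbertBasis]

/-- Cauchy–Schwarz followed by Bessel. With `s = 1 - α` this turns the input embedding into an
almost sure bound on the signal. -/
theorem sq_inner_blockVec_specPow_le (e : HilbertBasis ℕ ℝ HK) {μ : ℕ → ℝ} {Cμ s : ℝ}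
    (hμ0 : ∀ i, 0 < μ i) (hμC : ∀ i, μ i ≤ Cμ) (hs : 0 ≤ s) (a : ℝ) (S : Finset ℕ) (w : HK) :
    inner ℝ (blockVec e a S) (specPow e μ (s / 2) w) ^ 2
      ≤ a ^ 2 * (∑ k ∈ S, μ k ^ s) * ‖w‖ ^ 2 := by
  rw [inner_blockVec, mul_pow, mul_assoc]
  refine mul_le_mul_of_nonneg_left ?_ (sq_nonneg a)
  have h1 : ∀ k, inner ℝ (e k) (specPow e μ (s / 2) w) = μ k ^ (s / 2) * inner ℝ (e k) w :=
    fun k => inner_specPow e hμ0 hμC (by linarith) w k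
  simp_rw [h1]
  refine (Finset.sum_mul_sq_le_sq_mul_sq S _ _).trans ?_
  have h2 : ∀ k, (μ k ^ (s / 2)) ^ 2 = μ k ^ s := fun k => by
    rw [← Real.rpow_natCast, ← Real.rpow_mul (hμ0 k).le]; congr 1; push_cast; ring
  simp_rw [h2]
  refine mul_le_mul_of_nonneg_left ?_
    (Finset.sum_nonneg fun k _ => Real.rpow_nonneg (hμ0 k).le _)
  simpa using e.orthonormal.sum_inner_products_le (s := S) (x := w)

theorem sourceCondition_blockOp (e : HilbertBasis ℕ ℝ HK) {μ : ℕ → ℝ}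
    (f : HilbertBasis ℕ ℝ HL) {ρ : ℕ → ℝ} {Cμ Cρ β γ B : ℝ}
    (hμ0 : ∀ i, 0 < μ i) (hμC : ∀ i, μ i ≤ Cμ) (hρ0 : ∀ i, 0 < ρ i) (hρC : ∀ i, ρ i ≤ Cρ)
    (hβ : β ≤ 1) (hγ : γ ≤ 1) (j : ℕ) (a : ℝ) (S : Finset ℕ)
    (h : a ^ 2 * (∑ k ∈ S, μ k ^ (1 - β)) * ρ j ^ (-(1 - γ)) ≤ B ^ 2) :
    SourceCondition e μ f ρ β γ (blockOp e f j a S) B := by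
  have hβ2 : 0 ≤ (1 - β) / 2 := by linarith
  have hγ2 : 0 ≤ (1 - γ) / 2 := by linarith
  -- The conjugated operator is again rank one, with `f j` as output and this `x` as input vector;
  -- it is the witness bounding the infimum in `bgNormSq`.
  set x : HK := ∑ k ∈ S, (a * μ k ^ ((1 - β) / 2) * ρ j ^ (-((1 - γ) / 2))) • e k with hx
  have hxi : ∀ u, inner ℝ x u
      = ∑ k ∈ S, (a * μ k ^ ((1 - β) / 2) * ρ j ^ (-((1 - γ) / 2))) * inner ℝ (e k) u := by
    intro u; simp [hx, sum_inner, inner_smul_left]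
  have hmap : ∀ u, ∃ hu : specPow e μ ((1 - β) / 2) u ∈ (ofCLM (blockOp e f j a S)).domain,
      (ofCLM (blockOp e f j a S)) ⟨specPow e μ ((1 - β) / 2) u, hu⟩
        = specPow f ρ ((1 - γ) / 2) (InnerProductSpace.rankOne ℝ (f j) x u) := by
    refine fun u => ⟨trivial, ?_⟩
    have : (ofCLM (blockOp e f j a S)) ⟨specPow e μ ((1 - β) / 2) u, trivial⟩
      = blockOp e f j a S (specPow e μ ((1 - β) / 2) u) := rfl
    rw [this, blockOp_apply, InnerProductSpace.rankOne_apply, specPow_smul_basis f hρ0 hρC hγ2,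
      inner_blockVec, hxi, Finset.mul_sum, Finset.mul_sum]
    congr 1
    refine Finset.sum_congr rfl fun k _ => ?_
    rw [inner_specPow e hμ0 hμC hβ2, Real.rpow_neg (hρ0 j).le]
    have := (Real.rpow_pos_of_pos (hρ0 j) ((1 - γ) / 2)).ne'
    field_simp
  refine (iInf₂_le (InnerProductSpace.rankOne ℝ (f j) x) hmap).trans ?_
  have hsq : ∀ i, ‖(InnerProductSpace.rankOne ℝ (f j) x) (e i)‖ₑ ^ 2
      = if i ∈ S then ENNReal.ofReal (a ^ 2 * μ i ^ (1 - β) * ρ j ^ (-(1 - γ))) else 0 := by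
    intro i
    have hin : inner ℝ x (e i)
        = if i ∈ S then a * μ i ^ ((1 - β) / 2) * ρ j ^ (-((1 - γ) / 2)) else 0 := by
      rw [hxi]; simp [inner_hilbertBasis]
    rw [InnerProductSpace.rankOne_apply, enorm_smul, hin]
    have hf1 : ‖f j‖ₑ = 1 := by
      rw [← ofReal_norm, f.orthonormal.1 j, ENNReal.ofReal_one]
    rw [hf1, mul_one]
    split_ifs with hi
    · rw [← ofReal_norm, ← ENNReal.ofReal_pow (norm_nonneg _), Real.norm_eq_abs, sq_abs]
      congr 1
      rw [mul_pow, mul_pow, ← Real.rpow_natCast (μ i ^ _), ← Real.rpow_mul (hμ0 i).le,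
        ← Real.rpow_natCast (ρ j ^ _), ← Real.rpow_mul (hρ0 j).le]
      congr 2
      · congr 1; push_cast; ring
      · push_cast; ring
    · simp
  unfold hsNormSq
  simp_rw [hsq]
  rw [tsum_eq_sum (s := S) fun i hi => by simp [hi]]
  rw [Finset.sum_congr rfl fun i hi => if_pos hi, ← ENNReal.ofReal_sum_of_nonneg fun i _ =>
    mul_nonneg (mul_nonneg (sq_nonneg a) (Real.rpow_nonneg (hμ0 i).le _))
      (Real.rpow_nonneg (hρ0 j).le _), ← Finset.sum_mul, ← Finset.mul_sum]
  exact ENNReal.ofReal_le_ofReal h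

end Spectral

/-! ### Second moments of linear functionals through the covariance operator -/

section Covariance

variable {H : Type*} [NormedAddCommGroup H] [InnerProductSpace ℝ H] [MeasurableSpace H]

/-- Without integrability the Bochner integral defaults to `0`, which has no positive eigenvalue. -/
theorem integrable_selfTensor_of_isEigenSystem {P : Measure H} {b : HilbertBasis ℕ ℝ H}
    {ev : ℕ → ℝ} (h : IsEigenSystem P b ev) (h0 : 0 < ev 0) : Integrable selfTensor P := by
  by_contra hn
  have h1 := h 0
  rw [covOp, integral_undef hn, zero_apply, eq_comm, smul_eq_zero] at h1
  rcases h1 with h1 | h1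
  · exact h0.ne' h1
  · exact b.orthonormal.ne_zero 0 h1

/-- The map `T ↦ ⟪x, T x⟫` is a continuous linear functional, hence commutes with the Bochner
integral. -/
theorem integral_sq_inner [CompleteSpace H] {P : Measure H} (h : Integrable selfTensor P) (x : H) :
    Integrable (fun u => inner ℝ x u ^ 2) P ∧ ∫ u, inner ℝ x u ^ 2 ∂P = inner ℝ x (covOp P x) := by
  let φ : (H →L[ℝ] H) →L[ℝ] ℝ := (innerSL ℝ x).comp (ContinuousLinearMap.apply ℝ H x)
  have hφ : ∀ u : H, φ (selfTensor u) = inner ℝ x u ^ 2 := fun u => by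
    simp [φ, selfTensor, real_inner_comm, sq]
  constructor
  · exact (φ.integrable_comp h).congr (Filter.Eventually.of_forall hφ)
  · have := φ.integral_comp_comm h
    simp_rw [hφ] at this
    rw [this]; rfl

theorem integral_sq_inner_blockVec [CompleteSpace H] {P : Measure H} {b : HilbertBasis ℕ ℝ H} {ev : ℕ → ℝ}
    (h : IsEigenSystem P b ev) (hi : Integrable selfTensor P) (a : ℝ) (S : Finset ℕ) :
    ∫ u, inner ℝ (blockVec b a S) u ^ 2 ∂P = a ^ 2 * ∑ k ∈ S, ev k := by
  rw [(integral_sq_inner hi _).2]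
  conv_lhs => rw [blockVec, map_sum]
  rw [← blockVec, inner_sum, Finset.mul_sum]
  refine Finset.sum_congr rfl fun k hk => ?_
  rw [map_smul, h k, inner_smul_right, inner_smul_right, inner_blockVec_basis, if_pos hk]
  ring

end Covariance

/-! ### Two-point laws -/

section TwoPoint

variable {X : Type*} [MeasurableSpace X]

/-- The law on `{x, y}` whose masses differ by `c`. -/
def twoPoint (c : ℝ) (x y : X) : Measure X :=
  ENNReal.ofReal ((1 + c) / 2) • Measure.dirac x + ENNReal.ofReal ((1 - c) / 2) • Measure.dirac y

theorem isProbabilityMeasure_twoPoint {c : ℝ} (hc : |c| ≤ 1) (x y : X) :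
    IsProbabilityMeasure (twoPoint c x y) := by
  obtain ⟨h1, h2⟩ := abs_le.1 hc
  refine ⟨?_⟩
  simp only [twoPoint, Measure.coe_add, Measure.coe_smul, Pi.add_apply, Pi.smul_apply,
    measure_univ, smul_eq_mul, mul_one]
  rw [← ENNReal.ofReal_add (by linarith) (by linarith), ← ENNReal.ofReal_one]
  congr 1; ring

variable [MeasurableSingletonClass X]

theorem lintegral_twoPoint (c : ℝ) (x y : X) (g : X → ℝ≥0∞) :
    ∫⁻ v, g v ∂twoPoint c x y
      = ENNReal.ofReal ((1 + c) / 2) * g x + ENNReal.ofReal ((1 - c) / 2) * g y := by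
  simp [twoPoint, lintegral_add_measure, lintegral_smul_measure]

theorem integral_twoPoint {E : Type*} [NormedAddCommGroup E] [NormedSpace ℝ E] [CompleteSpace E]
    {c : ℝ} (hc : |c| ≤ 1) (x y : X) (g : X → E) :
    Integrable g (twoPoint c x y) ∧
      ∫ v, g v ∂twoPoint c x y = ((1 + c) / 2) • g x + ((1 - c) / 2) • g y := by
  obtain ⟨h1, h2⟩ := abs_le.1 hc
  have hx : Integrable g (ENNReal.ofReal ((1 + c) / 2) • Measure.dirac x) :=
    (integrable_dirac (by simp)).smul_measure ENNReal.ofReal_ne_top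
  have hy : Integrable g (ENNReal.ofReal ((1 - c) / 2) • Measure.dirac y) :=
    (integrable_dirac (by simp)).smul_measure ENNReal.ofReal_ne_top
  refine ⟨hx.add_measure hy, ?_⟩
  rw [twoPoint, integral_add_measure hx hy, integral_smul_measure, integral_smul_measure,
    integral_dirac, integral_dirac, ENNReal.toReal_ofReal (by linarith),
    ENNReal.toReal_ofReal (by linarith)]

theorem withDensity_twoPoint_zero (c : ℝ) (x y : X) {g : X → ℝ≥0∞}
    (hx : g x = ENNReal.ofReal (1 + c)) (hy : g y = ENNReal.ofReal (1 - c)) :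
    (twoPoint 0 x y).withDensity g = twoPoint c x y := by
  ext s hs
  rw [withDensity_apply _ hs, ← lintegral_indicator hs, lintegral_twoPoint,
    ← lintegral_indicator_one hs, lintegral_twoPoint]
  congr 1
  · by_cases h : x ∈ s
    · simp only [h, Set.indicator_of_mem, hx, Pi.one_apply, mul_one]
      rw [← ENNReal.ofReal_mul (by norm_num)]
      congr 1; ring
    · simp [h]
  · by_cases h : y ∈ s
    · simp only [h, Set.indicator_of_mem, hy, Pi.one_apply, mul_one]
      rw [← ENNReal.ofReal_mul (by norm_num)]
      congr 1; ring
    · simp [h]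

end TwoPoint

/-- Truncation of a real number to `[-1, 1]`. -/
def clip (t : ℝ) : ℝ := max (-1) (min 1 t)

theorem abs_clip_le (t : ℝ) : |clip t| ≤ 1 :=
  abs_le.2 ⟨le_max_left _ _, max_le (by norm_num) (min_le_left _ _)⟩

theorem clip_eq_self {t : ℝ} (ht : |t| ≤ 1) : clip t = t := by
  obtain ⟨h1, h2⟩ := abs_le.1 ht
  rw [clip, min_eq_right h2, max_eq_right h1]

theorem abs_clip_le_abs (t : ℝ) : |clip t| ≤ |t| := by
  rcases le_total |t| 1 with h | h
  · rw [clip_eq_self h]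
  · exact (abs_clip_le t).trans h

theorem measurable_clip : Measurable clip :=
  measurable_const.max (measurable_const.min measurable_id)

/-! ### The regression model with sign noise -/

section Model

variable {HK HL : Type*} [NormedAddCommGroup HK] [InnerProductSpace ℝ HK]
  [NormedAddCommGroup HL] [InnerProductSpace ℝ HL]

theorem selfTensor_smul_pow {y : HL} (hy : ‖y‖ = 1) (t : ℝ) {k : ℕ} (hk : k ≠ 0) :
    selfTensor (t • y) ^ k = (t ^ (2 * k)) • selfTensor y := by
  have h1 : selfTensor (t • y) = t ^ 2 • selfTensor y := by
    simp [selfTensor, smul_smul, sq]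
  rw [h1, smul_pow, ← pow_mul]
  obtain ⟨n, rfl⟩ := Nat.exists_eq_succ_of_ne_zero hk
  congr 1
  exact (InnerProductSpace.isIdempotentElem_rankOne_self (𝕜 := ℝ) hy).pow_succ_eq n

/-- Density of the sign noise model with respect to pure noise. -/
def signDensity (τ : ℝ) (x : HK) (y : HL) (u : HK) (v : HL) : ℝ≥0∞ :=
  ENNReal.ofReal (1 + clip (inner ℝ x u / τ) * (inner ℝ y v / τ))

theorem signDensity_pos_neg {τ : ℝ} (hτ : τ ≠ 0) (x u : HK) {y : HL} (hy : ‖y‖ = 1) :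
    signDensity τ x y u (τ • y) = ENNReal.ofReal (1 + clip (inner ℝ x u / τ)) ∧
      signDensity τ x y u (-(τ • y)) = ENNReal.ofReal (1 - clip (inner ℝ x u / τ)) := by
  constructor
  · simp [signDensity, inner_smul_right, hy, hτ]
  · simp [signDensity, inner_smul_right, inner_neg_right, hy, hτ,
      sub_eq_add_neg]

variable [MeasurableSpace HK] [BorelSpace HK] [MeasurableSpace HL] [BorelSpace HL]

/-- The law of pure sign noise `± τ y`. -/
def signNoise (τ : ℝ) (y : HL) : Measure HL := twoPoint 0 (τ • y) (-(τ • y))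

instance (τ : ℝ) (y : HL) : IsProbabilityMeasure (signNoise τ y) :=
  isProbabilityMeasure_twoPoint (by norm_num) _ _

theorem measurable_signDensity (τ : ℝ) (x : HK) (y : HL) :
    Measurable (Function.uncurry (signDensity τ x y)) := by
  have h1 : Measurable fun u : HK => inner ℝ x u := (innerSL ℝ x).continuous.measurable
  have h2 : Measurable fun v : HL => inner ℝ y v := (innerSL ℝ y).continuous.measurable
  exact ENNReal.measurable_ofReal.comp (measurable_const.add
    ((measurable_clip.comp ((h1.comp measurable_fst).div_const τ)).mul
      ((h2.comp measurable_snd).div_const τ)))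

/-- The conditional law `± τ y` whose mean is `⟪x, u⟫ y` as long as `|⟪x, u⟫| ≤ τ`. -/
def signKernel (τ : ℝ) (x : HK) (y : HL) : Kernel HK HL :=
  (Kernel.const HK (signNoise τ y)).withDensity (signDensity τ x y)

theorem signKernel_apply {τ : ℝ} (hτ : τ ≠ 0) (x u : HK) {y : HL} (hy : ‖y‖ = 1) :
    signKernel τ x y u = twoPoint (clip (inner ℝ x u / τ)) (τ • y) (-(τ • y)) := by
  rw [signKernel, Kernel.withDensity_apply _ (measurable_signDensity τ x y), Kernel.const_apply]
  obtain ⟨h1, h2⟩ := signDensity_pos_neg hτ x u hy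
  exact withDensity_twoPoint_zero _ _ _ h1 h2

theorem isMarkovKernel_signKernel {τ : ℝ} (hτ : τ ≠ 0) (x : HK) {y : HL} (hy : ‖y‖ = 1) :
    IsMarkovKernel (signKernel τ x y) :=
  ⟨fun u => by
    rw [signKernel_apply hτ x u hy]
    exact isProbabilityMeasure_twoPoint (abs_clip_le _) _ _⟩

theorem compProd_signKernel {τ : ℝ} (hτ : τ ≠ 0) (PK : Measure HK) [IsProbabilityMeasure PK]
    (x : HK) {y : HL} (hy : ‖y‖ = 1) :
    PK ⊗ₘ signKernel τ x y
      = (PK.prod (signNoise τ y)).withDensity (Function.uncurry (signDensity τ x y)) := by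
  have := isMarkovKernel_signKernel hτ x hy
  unfold signKernel at this ⊢
  rw [Measure.compProd_withDensity (measurable_signDensity τ x y), Measure.compProd_const]
  rfl

/-- Over a fair sign, `(1 ± c)²` averages to `1 + c²`, and truncation only decreases `c²`. -/
theorem lintegral_sq_signDensity_le {τ : ℝ} (hτ : τ ≠ 0) (PK : Measure HK)
    [IsProbabilityMeasure PK] (x : HK) {y : HL} (hy : ‖y‖ = 1)
    (hi : Integrable (fun u => inner ℝ x u ^ 2) PK) :
    ∫⁻ z, Function.uncurry (signDensity τ x y) z ^ 2 ∂(PK.prod (signNoise τ y))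
      ≤ ENNReal.ofReal (1 + (∫ u, inner ℝ x u ^ 2 ∂PK) / τ ^ 2) := by
  rw [lintegral_prod _ ((measurable_signDensity τ x y).pow_const 2).aemeasurable]
  have hin : ∀ u, ∫⁻ v, Function.uncurry (signDensity τ x y) (u, v) ^ 2 ∂(signNoise τ y)
      ≤ ENNReal.ofReal (1 + inner ℝ x u ^ 2 / τ ^ 2) := fun u => by
    obtain ⟨h1, h2⟩ := signDensity_pos_neg hτ x u hy
    obtain ⟨h3, h4⟩ := abs_le.1 (abs_clip_le (inner ℝ x u / τ))
    have h5 := sq_le_sq.2 (abs_clip_le_abs (inner ℝ x u / τ))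
    rw [signNoise, lintegral_twoPoint]
    simp only [Function.uncurry_apply_pair]
    rw [h1, h2, ← ENNReal.ofReal_pow (by linarith), ← ENNReal.ofReal_pow (by linarith),
      ← ENNReal.ofReal_mul (by norm_num), ← ENNReal.ofReal_mul (by norm_num),
      ← ENNReal.ofReal_add (by positivity) (by positivity)]
    refine ENNReal.ofReal_le_ofReal ?_
    rw [div_pow] at h5
    linarith
  refine (lintegral_mono hin).trans ?_
  have hi' : Integrable (fun u => 1 + inner ℝ x u ^ 2 / τ ^ 2) PK :=
    (integrable_const 1).add (hi.div_const _)
  rw [← ofReal_integral_eq_lintegral_ofReal hi'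
    (Filter.Eventually.of_forall fun u => by positivity)]
  rw [integral_add (integrable_const 1) (hi.div_const _), integral_div]
  simp

/-- The `N`-sample second moment is at most `(1 + δ) ^ N ≤ exp (N δ)`, where `δ` is the signal
energy over the noise level `τ²`. -/
theorem sq_pi_compProd_signKernel_le {τ : ℝ} (hτ : τ ≠ 0) (PK : Measure HK)
    [IsProbabilityMeasure PK] (x : HK) {y : HL} (hy : ‖y‖ = 1)
    (hi : Integrable (fun u => inner ℝ x u ^ 2) PK) {N : ℕ} {L : ℝ}
    (hL : N * ((∫ u, inner ℝ x u ^ 2 ∂PK) / τ ^ 2) ≤ L)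
    {G : Set (Fin N → HK × HL)} (hG : MeasurableSet G) :
    (Measure.pi (fun _ : Fin N => PK ⊗ₘ signKernel τ x y) G) ^ 2
      ≤ ENNReal.ofReal (Real.exp L) * Measure.pi (fun _ : Fin N => PK.prod (signNoise τ y)) G := by
  have := isMarkovKernel_signKernel hτ x hy
  have hp : IsProbabilityMeasure (PK ⊗ₘ signKernel τ x y) := inferInstance
  rw [compProd_signKernel hτ PK x hy] at hp ⊢
  refine (sq_pi_withDensity_le _ _ (measurable_signDensity τ x y) hG).trans ?_
  gcongr
  rw [Fintype.card_fin]
  refine (pow_le_pow_left' (lintegral_sq_signDensity_le hτ PK x hy hi) N).trans ?_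
  set δ := (∫ u, inner ℝ x u ^ 2 ∂PK) / τ ^ 2
  have hδ : 0 ≤ δ := div_nonneg (integral_nonneg fun u => sq_nonneg _) (sq_nonneg _)
  rw [← ENNReal.ofReal_pow (by positivity)]
  refine ENNReal.ofReal_le_ofReal ?_
  calc (1 + δ) ^ N ≤ Real.exp δ ^ N := by
        gcongr; linarith [Real.add_one_le_exp δ]
    _ = Real.exp (N * δ) := (Real.exp_nat_mul δ N).symm
    _ ≤ Real.exp L := Real.exp_le_exp.2 hL

theorem isDataModel_signKernel [CompleteSpace HL] {τ : ℝ} (hτ : 0 < τ) (PK : Measure HK)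
    [IsProbabilityMeasure PK] (x : HK) {y : HL} (hy : ‖y‖ = 1)
    (hx : ∀ u ∈ PK.support, |inner ℝ x u| ≤ τ) :
    IsDataModel PK (PK ⊗ₘ signKernel τ x y) (signKernel τ x y)
      (InnerProductSpace.rankOne ℝ y x) := by
  have := isMarkovKernel_signKernel hτ.ne' x hy
  refine ⟨inferInstance, this, Measure.fst_compProd _ _, rfl, fun u _ => ?_, fun u hu => ?_⟩
  · rw [signKernel_apply hτ.ne' x u hy]
    exact (integral_twoPoint (abs_clip_le _) _ _ _).1
  -- Truncation keeps the kernel Markov at every `u`; on the support it is inactive, so the mean is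
  -- exact.
  · have hc : |inner ℝ x u / τ| ≤ 1 := by
      rw [abs_div, abs_of_pos hτ]; exact (div_le_one hτ).2 (hx u hu)
    rw [signKernel_apply hτ.ne' x u hy, (integral_twoPoint (abs_clip_le _) _ _ _).2,
      clip_eq_self hc, InnerProductSpace.rankOne_apply, smul_neg, smul_smul, smul_smul,
      ← neg_smul, ← add_smul]
    congr 1
    field_simp
    ring

theorem momentCondition_signKernel [CompleteSpace HL] {τ σ R : ℝ} (hτ : 0 < τ) (hσ : 2 * τ ≤ σ)
    (hR : 2 * τ ≤ R) (PK : Measure HK) (x : HK) (f : HilbertBasis ℕ ℝ HL) (j : ℕ)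
    (hx : ∀ u ∈ PK.support, |inner ℝ x u| ≤ τ) :
    MomentCondition PK (signKernel τ x (f j)) (InnerProductSpace.rankOne ℝ (f j) x) f σ R := by
  have hy : ‖f j‖ = 1 := f.orthonormal.1 j
  have hpos : (selfTensor (f j)).IsPositive := InnerProductSpace.isPositive_rankOne_self _
  -- All residuals are multiples `t • f j` with `|t| ≤ 2τ ≤ min R σ`, so `t ^ (2k) ≤ R ^ (2k-2) σ²`
  -- and one multiple of the projection onto `f j` serves for all `k`.
  refine ⟨σ ^ 2 • selfTensor (f j), hpos.smul_of_nonneg (sq_nonneg σ), ?_, fun u hu k hk => ?_⟩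
  · rw [tsum_eq_single j]
    · simp [selfTensor, inner_smul_left, hy]
    · intro i hi
      simp [selfTensor, inner_hilbertBasis, hi.symm]
  · set c := clip (inner ℝ x u / τ)
    have hc : |c| ≤ 1 := abs_clip_le _
    obtain ⟨hc1, hc2⟩ := abs_le.1 hc
    set h : ℝ := inner ℝ x u
    obtain ⟨hh1, hh2⟩ := abs_le.1 (hx u hu)
    rw [signKernel_apply hτ.ne' x u hy]
    obtain ⟨hint, hval⟩ := integral_twoPoint hc (τ • f j) (-(τ • f j))
      fun v => selfTensor (v - InnerProductSpace.rankOne ℝ (f j) x u) ^ k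
    refine ⟨hint, ?_⟩
    have e1 : τ • f j - InnerProductSpace.rankOne ℝ (f j) x u = (τ - h) • f j := by
      rw [InnerProductSpace.rankOne_apply, sub_smul]
    have e2 : -(τ • f j) - InnerProductSpace.rankOne ℝ (f j) x u = (-τ - h) • f j := by
      rw [InnerProductSpace.rankOne_apply, sub_smul, neg_smul]
    rw [hval, e1, e2, selfTensor_smul_pow hy _ (by omega), selfTensor_smul_pow hy _ (by omega),
      smul_smul, smul_smul, smul_smul, ← add_smul, ← sub_smul]
    refine hpos.smul_of_nonneg ?_
    have hbd : ∀ t : ℝ, |t| ≤ 2 * τ → t ^ (2 * k) ≤ R ^ (2 * k - 2) * σ ^ 2 := fun t ht => by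
      calc t ^ (2 * k) = |t| ^ (2 * k) := (Even.pow_abs (even_two_mul k) t).symm
        _ = |t| ^ (2 * k - 2) * |t| ^ 2 := by rw [← pow_add]; congr 1; omega
        _ ≤ R ^ (2 * k - 2) * σ ^ 2 := by
          gcongr
          · exact pow_nonneg (by linarith) _
          · exact ht.trans hR
          · exact ht.trans hσ
    have b1 := hbd (τ - h) (abs_le.2 ⟨by linarith, by linarith⟩)
    have b2 := hbd (-τ - h) (abs_le.2 ⟨by linarith, by linarith⟩)
    have hfac : (1 : ℝ) ≤ 1 / 2 * (Nat.factorial (2 * k) : ℝ) := by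
      have : 2 * k ≤ Nat.factorial (2 * k) := Nat.self_le_factorial _
      have : (2 : ℝ) ≤ Nat.factorial (2 * k) := by
        exact_mod_cast (by omega : 2 ≤ 2 * k).trans this
      linarith
    have hRσ : 0 ≤ R ^ (2 * k - 2) * σ ^ 2 :=
      mul_nonneg (pow_nonneg (by linarith) _) (sq_nonneg _)
    have m1 := mul_le_mul_of_nonneg_left b1 (by linarith : 0 ≤ (1 + c) / 2)
    have m2 := mul_le_mul_of_nonneg_left b2 (by linarith : 0 ≤ (1 - c) / 2)
    have m3 := mul_le_mul_of_nonneg_right hfac hRσ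
    rw [sub_nonneg]
    calc _ ≤ R ^ (2 * k - 2) * σ ^ 2 := by linarith
      _ ≤ 1 / 2 * (Nat.factorial (2 * k) : ℝ) * (R ^ (2 * k - 2) * σ ^ 2) := by linarith
      _ = _ := by ring

end Model

/-- Per coordinate, `exp (1/20) ≤ 16/15` and `(16/15)(3/2) = 8/5`; the surplus `2 / (8/5) = 5/4`,
raised to the power `64`, exceeds `10000`. -/
theorem card_testing_bound {n : ℕ} (hn : 64 ≤ n) :
    10000 * (Real.exp (n / 20) * (3 / 2) ^ n) < (2 : ℝ) ^ n := by
  have h1 : Real.exp (1 / 20) ≤ 16 / 15 := by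
    have h := Real.add_one_le_exp (-(1 / 20) : ℝ)
    rw [Real.exp_neg, le_inv_comm₀ (by norm_num) (Real.exp_pos _)] at h
    exact h.trans (by norm_num)
  have h2 : Real.exp (n / 20) ≤ (16 / 15) ^ n := by
    rw [show (n : ℝ) / 20 = n * (1 / 20) by ring, Real.exp_nat_mul]
    gcongr
  have h3 : (10000 : ℝ) < (5 / 4) ^ n :=
    lt_of_lt_of_le (by norm_num) (pow_le_pow_right₀ (by norm_num : (1 : ℝ) ≤ 5 / 4) hn)
  calc 10000 * (Real.exp (n / 20) * (3 / 2) ^ n)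
      ≤ 10000 * ((16 / 15) ^ n * (3 / 2) ^ n) := by gcongr
    _ = 10000 * (8 / 5) ^ n := by rw [← mul_pow]; norm_num
    _ < (5 / 4) ^ n * (8 / 5) ^ n := by gcongr
    _ = 2 ^ n := by rw [← mul_pow]; norm_num

/-! ### Hard instances and the two rates -/

section Main

variable {HK HL : Type*}
  [NormedAddCommGroup HK] [InnerProductSpace ℝ HK] [MeasurableSpace HK]
  [NormedAddCommGroup HL] [InnerProductSpace ℝ HL] [MeasurableSpace HL]

/-- Some admissible data distribution makes the squared `(β', γ')`-error of the estimator at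
least `r` with probability at least `0.99`. -/
def HasHardInstance (PK : Measure HK) (e : HilbertBasis ℕ ℝ HK) (μ : ℕ → ℝ)
    (f : HilbertBasis ℕ ℝ HL) (ρ : ℕ → ℝ) (β γ β' γ' A₂ σ R B : ℝ) {N : ℕ}
    (estimator : (Fin N → HK × HL) → (HK →ₗ.[ℝ] HL)) (r : ℝ) : Prop :=
  ∃ (A₀ : HK →L[ℝ] HL) (PKL : Measure (HK × HL)) (κ : Kernel HK HL),
    IsDataModel PK PKL κ A₀ ∧ OutputBounded PK A₀ A₂ ∧ MomentCondition PK κ A₀ f σ R ∧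
    SourceCondition e μ f ρ β γ A₀ B ∧
    ENNReal.ofReal 0.99 ≤ Measure.pi (fun _ : Fin N => PKL)
      {D | ENNReal.ofReal r ≤ bgNormSq e μ f ρ β' γ' (estimator D - ofCLM A₀)}

theorem HasHardInstance.mono {PK : Measure HK} {e : HilbertBasis ℕ ℝ HK} {μ : ℕ → ℝ}
    {f : HilbertBasis ℕ ℝ HL} {ρ : ℕ → ℝ} {β γ β' γ' A₂ σ R B : ℝ} {N : ℕ}
    {estimator : (Fin N → HK × HL) → (HK →ₗ.[ℝ] HL)} {r r' : ℝ}
    (h : HasHardInstance PK e μ f ρ β γ β' γ' A₂ σ R B estimator r) (hr : r' ≤ r) :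
    HasHardInstance PK e μ f ρ β γ β' γ' A₂ σ R B estimator r' := by
  obtain ⟨A₀, PKL, κ, h1, h2, h3, h4, h5⟩ := h
  exact ⟨A₀, PKL, κ, h1, h2, h3, h4, h5.trans
    (measure_mono fun D hD => (ENNReal.ofReal_le_ofReal hr).trans hD)⟩

variable [BorelSpace HK] [BorelSpace HL] [CompleteSpace HK] [CompleteSpace HL]

/-- `hout` and `hsrc` make every subset hypothesis admissible, `hinf` keeps all of them close to
pure noise, and `hsep` makes a single coordinate flip cost at least `32 r / n` in squared norm,
where `n = I.card`. -/
theorem hasHardInstance_of_block (PK : Measure HK) [IsProbabilityMeasure PK]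
    (e : HilbertBasis ℕ ℝ HK) {μ : ℕ → ℝ} (f : HilbertBasis ℕ ℝ HL) {ρ : ℕ → ℝ}
    (hμ : IsEigenSystem PK e μ) {Cμ Cρ α β γ β' γ' A₁ A₂ τ σ R B r a : ℝ}
    (hμ0 : ∀ i, 0 < μ i) (hμC : ∀ i, μ i ≤ Cμ) (hρ0 : ∀ i, 0 < ρ i) (hρC : ∀ i, ρ i ≤ Cρ)
    (hα : α ≤ 1) (hemb : InputEmbedding PK e μ α A₁)
    (hβ : β ≤ 1) (hγ : γ ≤ 1) (hβ' : β' ≤ 1) (hγ' : γ' ≤ 1)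
    (hA₂ : 0 ≤ A₂) (hτ : 0 < τ) (hτσ : 2 * τ ≤ σ) (hτR : 2 * τ ≤ R) (hr : 0 < r)
    (I : Finset ℕ) (hI : 64 ≤ I.card) (j N : ℕ)
    (hout : a ^ 2 * (∑ k ∈ I, μ k ^ (1 - α)) * A₁ ^ 2 ≤ min τ A₂ ^ 2)
    (hsrc : a ^ 2 * (∑ k ∈ I, μ k ^ (1 - β)) * ρ j ^ (-(1 - γ)) ≤ B ^ 2)
    (hinf : N * (a ^ 2 * ∑ k ∈ I, μ k) ≤ τ ^ 2 * (I.card / 20))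
    (hsep : ∀ k ∈ I, 32 * r ≤ μ k ^ (1 - β') * ρ j ^ (-(1 - γ')) * a ^ 2 * I.card)
    (estimator : (Fin N → HK × HL) → (HK →ₗ.[ℝ] HL)) :
    HasHardInstance PK e μ f ρ β γ β' γ' A₂ σ R B estimator r := by
  have hy : ‖f j‖ = 1 := f.orthonormal.1 j
  have hn0 : (0 : ℝ) < I.card := by exact_mod_cast (by omega : 0 < I.card)
  have hmono : ∀ s : ℝ, ∀ S ⊆ I, ∑ k ∈ S, μ k ^ s ≤ ∑ k ∈ I, μ k ^ s := fun s S hS =>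
    Finset.sum_le_sum_of_subset_of_nonneg hS fun k _ _ => Real.rpow_nonneg (hμ0 k).le _
  have hae : ∀ S ⊆ I, ∀ᵐ u ∂PK, |inner ℝ (blockVec e a S) u| ≤ min τ A₂ := fun S hS => by
    filter_upwards [hemb] with u ⟨w, hw, hwA⟩
    refine abs_le_of_sq_le_sq ?_ (le_min hτ.le hA₂)
    rw [← hw]
    refine (sq_inner_blockVec_specPow_le e hμ0 hμC (by linarith) a S w).trans (le_trans ?_ hout)
    have := hmono (1 - α) S hS
    have : 0 ≤ ∑ k ∈ I, μ k ^ (1 - α) :=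
      Finset.sum_nonneg fun k _ => Real.rpow_nonneg (hμ0 k).le _
    gcongr
  -- The model conditions are required at every support point; a closed set of full measure contains
  -- the support.
  have hsupp : ∀ S ⊆ I, ∀ u ∈ PK.support, |inner ℝ (blockVec e a S) u| ≤ τ := fun S hS => by
    have hcl : IsClosed {u : HK | |inner ℝ (blockVec e a S) u| ≤ τ} :=
      isClosed_le (continuous_abs.comp (innerSL ℝ (blockVec e a S)).continuous) continuous_const
    refine fun u hu => Measure.support_subset_of_isClosed hcl ?_ hu
    filter_upwards [hae S hS] with u hu using hu.trans (min_le_left _ _)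
  have hint := integrable_selfTensor_of_isEigenSystem hμ (hμ0 0)
  obtain ⟨S, hSI, hS⟩ := exists_le_measure_compl I.powerset
    (Measure.pi fun _ : Fin N => PK.prod (signNoise τ (f j)))
    (fun S => Measure.pi fun _ : Fin N => PK ⊗ₘ signKernel τ (blockVec e a S) (f j))
    (fun S _ => by
      have := isMarkovKernel_signKernel hτ.ne' (blockVec e a S) hy
      infer_instance)
    (Real.exp (I.card / 20)) ((3 / 2) ^ I.card) (Real.exp_pos _).le (by positivity)
    (fun S hS G hG => by
      refine sq_pi_compProd_signKernel_le hτ.ne' PK _ hy (integral_sq_inner hint _).1 ?_ hG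
      rw [integral_sq_inner_blockVec hμ hint, ← mul_div_assoc, div_le_iff₀ (by positivity)]
      refine le_trans ?_ (hinf.trans_eq (mul_comm _ _))
      have := Finset.sum_le_sum_of_subset_of_nonneg (Finset.mem_powerset.1 hS)
        fun k _ _ => (hμ0 k).le
      gcongr)
    (fun S => {D | bgNormSq e μ f ρ β' γ' (estimator D - ofCLM (blockOp e f j a S))
      < ENNReal.ofReal r})
    -- Hypotheses accepted by the same data lie in a Hamming ball around any one of them: the sum
    -- over `symmDiff S T` is at most `4 r`, so `32 r |S ∆ T| / n ≤ 4 r`.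
    (fun J hJ D hD => by
      rcases J.eq_empty_or_nonempty with rfl | ⟨S, hSJ⟩
      · simp only [Finset.card_empty, Nat.cast_zero]; positivity
      refine card_hammingBall_le I (Finset.mem_powerset.1 (hJ hSJ)) J hJ fun T hTJ => ?_
      have hsum := sum_sq_inner_le_of_bgNormSq_lt e f hμ0 hμC hρ0 hρC hβ' hγ' hr.le (estimator D)
        _ _ (hD S hSJ) (hD T hTJ) j (symmDiff S T)
      have hle : ∀ i ∈ symmDiff S T, 32 * r / I.card ≤ μ i ^ (1 - β') * ρ j ^ (-(1 - γ'))
          * inner ℝ (f j) (blockOp e f j a T (e i) - blockOp e f j a S (e i)) ^ 2 := by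
        intro i hi
        have hiI : i ∈ I := by
          rcases Finset.mem_symmDiff.1 hi with h | h
          · exact Finset.mem_powerset.1 (hJ hSJ) h.1
          · exact Finset.mem_powerset.1 (hJ hTJ) h.1
        have hsq : inner ℝ (f j) (blockOp e f j a T (e i) - blockOp e f j a S (e i)) ^ 2
            = a ^ 2 := by
          rw [blockOp_apply, blockOp_apply, ← sub_smul, inner_smul_right,
            real_inner_self_eq_norm_sq, hy, inner_blockVec_basis, inner_blockVec_basis]
          rcases Finset.mem_symmDiff.1 hi with h | h <;> simp [h.1, h.2]
        rw [hsq, div_le_iff₀ hn0]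
        exact hsep i hiI
      have h1 := (Finset.card_nsmul_le_sum _ _ _ hle).trans hsum
      rw [nsmul_eq_mul, ← mul_div_assoc, div_le_iff₀ hn0] at h1
      have h2 : (8 * (symmDiff S T).card : ℝ) ≤ I.card := by
        have h3 : r * (8 * ((symmDiff S T).card : ℝ)) ≤ r * I.card := by linarith
        exact le_of_mul_le_mul_left h3 hr
      exact_mod_cast h2)
    (by
      rw [Finset.card_powerset]
      push_cast
      exact card_testing_bound hI)
  rw [Finset.mem_powerset] at hSI
  refine ⟨blockOp e f j a S, PK ⊗ₘ signKernel τ (blockVec e a S) (f j),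
    signKernel τ (blockVec e a S) (f j), isDataModel_signKernel hτ PK _ hy (hsupp S hSI), ?_,
    momentCondition_signKernel hτ hτσ hτR PK _ f j (hsupp S hSI), ?_, ?_⟩
  · filter_upwards [hae S hSI] with u hu
    rw [blockOp_apply, norm_smul, hy, mul_one, Real.norm_eq_abs]
    exact hu.trans (min_le_right _ _)
  · refine sourceCondition_blockOp e f hμ0 hμC hρ0 hρC hβ hγ j a S (le_trans ?_ hsrc)
    have := hmono (1 - β) S hSI
    have := Real.rpow_nonneg (hρ0 j).le (-(1 - γ))
    gcongr
  · refine hS.trans (measure_mono fun D hD => ?_)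
    simpa using hD

theorem PolynomialDecay.pos {ev : ℕ → ℝ} {p : ℝ} (h : PolynomialDecay ev p) (i : ℕ) :
    0 < ev i := by
  obtain ⟨c, C, hc, -, h⟩ := h
  exact lt_of_lt_of_le (by positivity) (h i).1

theorem PolynomialDecay.exists_le {ev : ℕ → ℝ} {p : ℝ} (hp : 0 < p) (h : PolynomialDecay ev p) :
    ∃ C, ∀ i, ev i ≤ C := by
  obtain ⟨c, C, -, hC, h⟩ := h
  refine ⟨C, fun i => (h i).2.trans (mul_le_of_le_one_right hC.le ?_)⟩
  exact Real.rpow_le_one_of_one_le_of_nonpos (by linarith [(Nat.cast_nonneg i : (0 : ℝ) ≤ i)])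
    (by have := div_pos one_pos hp; linarith)

theorem exists_pos_mul_le {x₁ x₂ x₃ y₁ y₂ y₃ : ℝ} (hx₁ : 0 ≤ x₁) (hx₂ : 0 ≤ x₂) (hx₃ : 0 ≤ x₃)
    (hy₁ : 0 < y₁) (hy₂ : 0 < y₂) (hy₃ : 0 < y₃) :
    ∃ k : ℝ, 0 < k ∧ k * x₁ ≤ y₁ ∧ k * x₂ ≤ y₂ ∧ k * x₃ ≤ y₃ := by
  have key : ∀ {x y k : ℝ}, 0 ≤ x → 0 < y → k ≤ y / (x + 1) → k * x ≤ y := by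
    intro x y k hx hy hk
    calc k * x ≤ y / (x + 1) * x := by gcongr
      _ = y * (x / (x + 1)) := by ring
      _ ≤ y * 1 := by gcongr; rw [div_le_one (by linarith)]; linarith
      _ = y := mul_one y
  refine ⟨min (y₁ / (x₁ + 1)) (min (y₂ / (x₂ + 1)) (y₃ / (x₃ + 1))), by positivity,
    key hx₁ hy₁ (min_le_left _ _), key hx₂ hy₂ ((min_le_right _ _).trans (min_le_left _ _)),
    key hx₃ hy₃ ((min_le_right _ _).trans (min_le_right _ _))⟩

/-- The calibration for general block size `d` and output index `j`. The two rates differ only in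
how `d` and `j` are balanced against `N` under the information budget with constant `K`. -/
theorem exists_hasHardInstance (PK : Measure HK) [IsProbabilityMeasure PK]
    (e : HilbertBasis ℕ ℝ HK) {μ : ℕ → ℝ} (f : HilbertBasis ℕ ℝ HL) {ρ : ℕ → ℝ}
    (hμ : IsEigenSystem PK e μ) {Cρ p α β γ β' γ' A₁ : ℝ}
    (hp : 0 < p) (hμp : PolynomialDecay μ p) (hρ0 : ∀ i, 0 < ρ i) (hρC : ∀ i, ρ i ≤ Cρ)
    (hα : α ≤ 1) (hemb : InputEmbedding PK e μ α A₁)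
    (hβ : β ≤ 1) (hγ : γ ≤ 1) (hβ' : β' ≤ 1) (hγ' : γ' ≤ 1)
    {A₂ σ R B : ℝ} (hA₂ : 0 < A₂) (hσ : 0 < σ) (hR : 0 < R) (hB : 0 < B) {K : ℝ} (hK : 0 ≤ K) :
    ∃ c : ℝ, 0 < c ∧ ∀ N d j : ℕ, 64 ≤ d →
      N * ρ j ^ (1 - γ) * ((d : ℝ) ^ (-(1 / p))) ^ max α β ≤ K * d →
      ∀ estimator : (Fin N → HK × HL) → (HK →ₗ.[ℝ] HL),
        HasHardInstance PK e μ f ρ β γ β' γ' A₂ σ R B estimator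
          (c * ρ j ^ (γ' - γ) * ((d : ℝ) ^ (-(1 / p))) ^ (max α β - β')) := by
  obtain ⟨c₁, C₁, hc₁, hC₁, hdec⟩ := id hμp
  have hμ0 := hμp.pos
  obtain ⟨Cμ, hμC⟩ := hμp.exists_le hp
  have hCρ : 0 < Cρ := (hρ0 0).trans_le (hρC 0)
  set s := max α β
  have hs1 : s ≤ 1 := max_le hα hβ
  have hαs : α ≤ s := le_max_left _ _
  have hβs : β ≤ s := le_max_right _ _
  set τ := min R σ / 2 with hτdef
  have hτ : 0 < τ := by positivity
  -- The factor `k` in `a²` is made small enough for the output bound, the source bound and the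
  -- information budget, uniformly in `N`, `d` and `j`.
  obtain ⟨k, hk, hk1, hk2, hk3⟩ := exists_pos_mul_le
    (x₁ := Cρ ^ (1 - γ) * C₁ ^ (1 - α) * A₁ ^ 2) (x₂ := C₁ ^ (1 - β)) (x₃ := K * C₁)
    (y₁ := min τ A₂ ^ 2) (y₂ := B ^ 2) (y₃ := τ ^ 2 / 20)
    (by positivity) (by positivity) (by positivity) (by positivity) (by positivity) (by positivity)
  set c₂ := c₁ * 2 ^ (-(1 / p)) with hc₂def
  have hc₂ : 0 < c₂ := by positivity
  refine ⟨k * c₂ ^ (1 - β') / 32, by positivity, fun N d j hd hN estimator => ?_⟩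
  have hd0 : (0 : ℝ) < d := by exact_mod_cast (by omega : 0 < d)
  set m := (d : ℝ) ^ (-(1 / p)) with hm
  have hm0 : 0 < m := Real.rpow_pos_of_pos hd0 _
  have hm1 : m ≤ 1 := Real.rpow_le_one_of_one_le_of_nonpos (by exact_mod_cast (by omega : 1 ≤ d))
    (by have := div_pos one_pos hp; linarith)
  have hexp : -(1 / p) ≤ 0 := by have := div_pos one_pos hp; linarith
  -- On a dyadic block all eigenvalues are comparable to `m`.
  have hup : ∀ i ∈ Finset.Ico d (2 * d), μ i ≤ C₁ * m := fun i hi => by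
    obtain ⟨h1, h2⟩ := Finset.mem_Ico.1 hi
    refine (hdec i).2.trans (mul_le_mul_of_nonneg_left ?_ hC₁.le)
    refine Real.rpow_le_rpow_of_nonpos hd0 ?_ hexp
    exact_mod_cast (by omega : d ≤ i + 1)
  have hlo : ∀ i ∈ Finset.Ico d (2 * d), c₂ * m ≤ μ i := fun i hi => by
    obtain ⟨h1, h2⟩ := Finset.mem_Ico.1 hi
    refine le_trans ?_ (hdec i).1
    rw [hc₂def, mul_assoc, hm, ← Real.mul_rpow (by norm_num) hd0.le]
    refine mul_le_mul_of_nonneg_left ?_ hc₁.le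
    refine Real.rpow_le_rpow_of_nonpos (by positivity) ?_ hexp
    exact_mod_cast (by omega : i + 1 ≤ 2 * d)
  have hcard : (Finset.Ico d (2 * d)).card = d := by rw [Nat.card_Ico]; omega
  have hsum : ∀ t : ℝ, 0 ≤ t → ∑ i ∈ Finset.Ico d (2 * d), μ i ^ t ≤ d * (C₁ ^ t * m ^ t) :=
    fun t ht => by
      refine (Finset.sum_le_card_nsmul _ _ (C₁ ^ t * m ^ t) fun i hi => ?_).trans_eq ?_
      · rw [← Real.mul_rpow hC₁.le hm0.le]
        exact Real.rpow_le_rpow (hμ0 i).le (hup i hi) ht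
      · rw [hcard, nsmul_eq_mul]
  have hρj := hρ0 j
  have ha2 : 0 ≤ k * ρ j ^ (1 - γ) * m ^ (s - 1) / d := by positivity
  set a := Real.sqrt (k * ρ j ^ (1 - γ) * m ^ (s - 1) / d)
  have ha : a ^ 2 = k * ρ j ^ (1 - γ) * m ^ (s - 1) / d := Real.sq_sqrt ha2
  have hρle : ρ j ^ (1 - γ) ≤ Cρ ^ (1 - γ) := Real.rpow_le_rpow hρj.le (hρC j) (by linarith)
  -- This is where `s = max α β` enters: `t = α` is needed for the output bound and `t = β` for the
  -- source condition.
  have hmle : ∀ t : ℝ, t ≤ s → m ^ (s - 1) * m ^ (1 - t) ≤ 1 := fun t ht => by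
    rw [← Real.rpow_add hm0]
    exact Real.rpow_le_one hm0.le hm1 (by linarith)
  refine hasHardInstance_of_block PK e f hμ (a := a) (A₁ := A₁) (τ := τ) (α := α)
    hμ0 hμC hρ0 hρC hα hemb hβ hγ hβ' hγ' hA₂.le
    hτ (by rw [hτdef]; linarith [min_le_right R σ]) (by rw [hτdef]; linarith [min_le_left R σ])
    (by positivity) (Finset.Ico d (2 * d)) (by rw [hcard]; exact hd) j N ?_ ?_ ?_ ?_ estimator
  · rw [ha]
    calc _ ≤ k * ρ j ^ (1 - γ) * m ^ (s - 1) / d * (d * (C₁ ^ (1 - α) * m ^ (1 - α))) * A₁ ^ 2 := by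
          gcongr; exact hsum _ (by linarith)
      _ = k * (ρ j ^ (1 - γ) * C₁ ^ (1 - α) * A₁ ^ 2) * (m ^ (s - 1) * m ^ (1 - α)) := by
          field_simp
      _ ≤ k * (Cρ ^ (1 - γ) * C₁ ^ (1 - α) * A₁ ^ 2) * 1 := by
          gcongr; exact hmle α hαs
      _ ≤ _ := by rw [mul_one]; exact hk1
  · have hρρ : ρ j ^ (1 - γ) * ρ j ^ (-(1 - γ)) = 1 := by
      rw [← Real.rpow_add hρj, add_neg_cancel, Real.rpow_zero]
    rw [ha]
    calc _ ≤ k * ρ j ^ (1 - γ) * m ^ (s - 1) / d * (d * (C₁ ^ (1 - β) * m ^ (1 - β)))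
          * ρ j ^ (-(1 - γ)) := by
          gcongr; exact hsum _ (by linarith)
      _ = k * C₁ ^ (1 - β) * (m ^ (s - 1) * m ^ (1 - β)) * (ρ j ^ (1 - γ) * ρ j ^ (-(1 - γ))) := by
          field_simp
      _ ≤ k * C₁ ^ (1 - β) * 1 * (ρ j ^ (1 - γ) * ρ j ^ (-(1 - γ))) := by
          gcongr; exact hmle β hβs
      _ ≤ _ := by rw [hρρ, mul_one, mul_one]; exact hk2
  · rw [ha, hcard]
    have h1 := hsum 1 zero_le_one
    simp only [Real.rpow_one] at h1
    have hms : m ^ (s - 1) * m = m ^ s := by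
      nth_rewrite 2 [← Real.rpow_one m]
      rw [← Real.rpow_add hm0, sub_add_cancel]
    calc _ ≤ N * (k * ρ j ^ (1 - γ) * m ^ (s - 1) / d * (d * (C₁ * m))) := by gcongr
      _ = k * C₁ * (N * ρ j ^ (1 - γ) * (m ^ (s - 1) * m)) := by field_simp
      _ ≤ k * C₁ * (K * d) := by rw [hms]; gcongr
      _ = k * (K * C₁) * d := by ring
      _ ≤ τ ^ 2 / 20 * d := by gcongr
      _ = _ := by ring
  · intro i hi
    rw [ha, hcard]
    have hμlo : c₂ ^ (1 - β') * m ^ (1 - β') ≤ μ i ^ (1 - β') := by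
      rw [← Real.mul_rpow hc₂.le hm0.le]
      exact Real.rpow_le_rpow (by positivity) (hlo i hi) (by linarith)
    have hρρ : ρ j ^ (γ' - γ) = ρ j ^ (-(1 - γ')) * ρ j ^ (1 - γ) := by
      rw [← Real.rpow_add hρj]; congr 1; ring
    have hmm : m ^ (s - β') = m ^ (1 - β') * m ^ (s - 1) := by
      rw [← Real.rpow_add hm0]; congr 1; ring
    calc 32 * (k * c₂ ^ (1 - β') / 32 * ρ j ^ (γ' - γ) * m ^ (s - β'))
        = c₂ ^ (1 - β') * m ^ (1 - β') * ρ j ^ (-(1 - γ'))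
          * (k * ρ j ^ (1 - γ) * m ^ (s - 1) / d) * d := by
          rw [hρρ, hmm]; field_simp
      _ ≤ _ := by gcongr

/-- With `j = 0` the budget reads `N d ^ (-s/p) ≲ d`, so `d ≍ N ^ (p / (s + p))` is the balanced
block size. -/
theorem exists_hasHardInstance_input (PK : Measure HK) [IsProbabilityMeasure PK]
    (e : HilbertBasis ℕ ℝ HK) {μ : ℕ → ℝ} (f : HilbertBasis ℕ ℝ HL) {ρ : ℕ → ℝ}
    (hμ : IsEigenSystem PK e μ) {Cρ p α β γ β' γ' A₁ : ℝ}
    (hp : 0 < p) (hμp : PolynomialDecay μ p) (hρ0 : ∀ i, 0 < ρ i) (hρC : ∀ i, ρ i ≤ Cρ)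
    (hα0 : 0 < α) (hα : α ≤ 1) (hemb : InputEmbedding PK e μ α A₁)
    (hβ : β ≤ 1) (hγ : γ ≤ 1) (hβ'β : β' < β) (hγ' : γ' ≤ 1)
    {A₂ σ R B : ℝ} (hA₂ : 0 < A₂) (hσ : 0 < σ) (hR : 0 < R) (hB : 0 < B) :
    ∃ c : ℝ, 0 < c ∧ ∀ N : ℕ, 1 ≤ N →
      ∀ estimator : (Fin N → HK × HL) → (HK →ₗ.[ℝ] HL),
        HasHardInstance PK e μ f ρ β γ β' γ' A₂ σ R B estimator
          (c * (N : ℝ) ^ (-((max α β - β') / (max α β + p)))) := by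
  have hρ00 := hρ0 0
  obtain ⟨c, hc, H⟩ := exists_hasHardInstance PK e f hμ hp hμp hρ0 hρC hα hemb hβ hγ
    (hβ'β.le.trans hβ) hγ' hA₂ hσ hR hB (K := ρ 0 ^ (1 - γ)) (by positivity)
  set s := max α β
  have hs : 0 < s := hα0.trans_le (le_max_left _ _)
  have hsβ : 0 ≤ s - β' := by have : β ≤ s := le_max_right _ _; linarith
  refine ⟨c * ρ 0 ^ (γ' - γ) * (128 : ℝ) ^ (-(1 / p) * (s - β')), by positivity,
    fun N hN estimator => ?_⟩
  have hN1 : (1 : ℝ) ≤ N := by exact_mod_cast hN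
  have hN0 : (0 : ℝ) < N := by linarith
  set t : ℝ := (N : ℝ) ^ (p / (s + p))
  have ht1 : 1 ≤ t := Real.one_le_rpow hN1 (by positivity)
  have hceil1 := Nat.le_ceil t
  have hceil2 := Nat.ceil_lt_add_one (by linarith : 0 ≤ t)
  -- The factor `64` secures the minimal block size; since `t ≥ 1`, still `d ≤ 128 t`.
  have hd : 64 ≤ 64 * ⌈t⌉₊ := by
    have : 1 ≤ ⌈t⌉₊ := Nat.one_le_iff_ne_zero.2 (Nat.ceil_pos.2 (by linarith)).ne'
    omega
  set d := 64 * ⌈t⌉₊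
  have hdc : (d : ℝ) = 64 * (⌈t⌉₊ : ℝ) := by simp [d]
  have htd : t ≤ d := by rw [hdc]; linarith
  have hdt : (d : ℝ) ≤ 128 * t := by rw [hdc]; linarith
  have hd0 : (0 : ℝ) < d := by linarith
  have hNt : (N : ℝ) = t ^ ((s + p) / p) := by
    rw [← Real.rpow_mul hN0.le, div_mul_div_cancel₀ (by positivity), div_self hp.ne', Real.rpow_one]
  refine (H N d 0 hd ?_ estimator).mono ?_
  · rw [mul_comm (N : ℝ), mul_assoc]
    refine mul_le_mul_of_nonneg_left ?_ (by positivity)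
    calc (N : ℝ) * ((d : ℝ) ^ (-(1 / p))) ^ s
        ≤ (d : ℝ) ^ ((s + p) / p) * ((d : ℝ) ^ (-(1 / p))) ^ s := by
          rw [hNt]; gcongr
      _ = (d : ℝ) ^ ((s + p) / p + -(1 / p) * s) := by
          rw [← Real.rpow_mul hd0.le, ← Real.rpow_add hd0]
      _ = d := by
          rw [show (s + p) / p + -(1 / p) * s = 1 by field_simp; ring, Real.rpow_one]
  · rw [mul_assoc (c * _)]
    refine mul_le_mul_of_nonneg_left ?_ (by positivity)
    calc (128 : ℝ) ^ (-(1 / p) * (s - β')) * (N : ℝ) ^ (-((s - β') / (s + p)))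
        = (128 * t) ^ (-(1 / p) * (s - β')) := by
          rw [Real.mul_rpow (by norm_num) (by linarith), ← Real.rpow_mul hN0.le]
          congr 2
          field_simp
      _ ≤ (d : ℝ) ^ (-(1 / p) * (s - β')) :=
          Real.rpow_le_rpow_of_nonpos hd0 hdt
            (mul_nonpos_of_nonpos_of_nonneg (by have := div_pos one_pos hp; linarith) hsβ)
      _ = _ := Real.rpow_mul hd0.le _ _

/-- With `d = 64` fixed the budget only asks for `ρ j ^ (1-γ) ≲ 1 / N`, which `j ≍ N ^ (q / (1-γ))`
achieves: a high output frequency hides the signal in the noise. -/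
theorem exists_hasHardInstance_output (PK : Measure HK) [IsProbabilityMeasure PK]
    (e : HilbertBasis ℕ ℝ HK) {μ : ℕ → ℝ} (f : HilbertBasis ℕ ℝ HL) {ρ : ℕ → ℝ}
    (hμ : IsEigenSystem PK e μ) {p q α β γ β' γ' A₁ : ℝ}
    (hp : 0 < p) (hμp : PolynomialDecay μ p) (hq : 0 < q) (hρq : PolynomialDecay ρ q)
    (hα0 : 0 < α) (hα : α ≤ 1) (hemb : InputEmbedding PK e μ α A₁)
    (hβ : β ≤ 1) (hβ' : β' ≤ 1) (hγγ' : γ < γ') (hγ' : γ' ≤ 1)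
    {A₂ σ R B : ℝ} (hA₂ : 0 < A₂) (hσ : 0 < σ) (hR : 0 < R) (hB : 0 < B) :
    ∃ c : ℝ, 0 < c ∧ ∀ N : ℕ, 1 ≤ N →
      ∀ estimator : (Fin N → HK × HL) → (HK →ₗ.[ℝ] HL),
        HasHardInstance PK e μ f ρ β γ β' γ' A₂ σ R B estimator
          (c * (N : ℝ) ^ (-((γ' - γ) / (1 - γ)))) := by
  have hγ1 : 0 < 1 - γ := by linarith
  have hρ0 := hρq.pos
  obtain ⟨Cρ, hρC⟩ := hρq.exists_le hq
  obtain ⟨c₁, C₁, hc₁, hC₁, hdec⟩ := hρq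
  obtain ⟨c, hc, H⟩ := exists_hasHardInstance PK e f hμ hp hμp hρ0 hρC hα hemb hβ
    (hγγ'.le.trans hγ') hβ' hγ' hA₂ hσ hR hB (K := C₁ ^ (1 - γ)) (by positivity)
  set m : ℝ := ((64 : ℕ) : ℝ) ^ (-(1 / p))
  have hm0 : 0 < m := by positivity
  have hqexp : -(1 / q) ≤ 0 := by have := div_pos one_pos hq; linarith
  refine ⟨c * (c₁ * 3 ^ (-(1 / q))) ^ (γ' - γ) * m ^ (max α β - β'), by positivity,
    fun N hN estimator => ?_⟩
  have hN1 : (1 : ℝ) ≤ N := by exact_mod_cast hN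
  have hN0 : (0 : ℝ) < N := by linarith
  set t : ℝ := (N : ℝ) ^ (q / (1 - γ))
  have ht1 : 1 ≤ t := Real.one_le_rpow hN1 (by positivity)
  have hceil1 := Nat.le_ceil t
  have hceil2 := Nat.ceil_lt_add_one (by linarith : 0 ≤ t)
  set j := ⌈t⌉₊
  have hpow : ∀ x : ℝ, (t ^ (-(1 / q))) ^ x = (N : ℝ) ^ (-(x / (1 - γ))) := fun x => by
    rw [← Real.rpow_mul (by linarith), ← Real.rpow_mul hN0.le]
    congr 1
    field_simp
  have hup : ρ j ≤ C₁ * t ^ (-(1 / q)) := by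
    refine (hdec j).2.trans (mul_le_mul_of_nonneg_left ?_ hC₁.le)
    exact Real.rpow_le_rpow_of_nonpos (by linarith) (by linarith) hqexp
  -- The decay is stated in `j + 1`, and `j + 1 ≤ t + 2 ≤ 3 t`.
  have hlo : c₁ * 3 ^ (-(1 / q)) * t ^ (-(1 / q)) ≤ ρ j := by
    refine le_trans ?_ (hdec j).1
    rw [mul_assoc, ← Real.mul_rpow (by norm_num) (by linarith)]
    refine mul_le_mul_of_nonneg_left ?_ hc₁.le
    exact Real.rpow_le_rpow_of_nonpos (by linarith) (by linarith) hqexp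
  refine (H N 64 j le_rfl ?_ estimator).mono ?_
  · have h1 : ρ j ^ (1 - γ) ≤ C₁ ^ (1 - γ) * (N : ℝ)⁻¹ := by
      refine (Real.rpow_le_rpow (hρ0 j).le hup hγ1.le).trans_eq ?_
      rw [Real.mul_rpow hC₁.le (by positivity), hpow, div_self hγ1.ne', Real.rpow_neg_one]
    have h2 : m ^ max α β ≤ 1 := by
      refine Real.rpow_le_one hm0.le ?_ (hα0.le.trans (le_max_left _ _))
      exact Real.rpow_le_one_of_one_le_of_nonpos (by norm_num)
        (by have := div_pos one_pos hp; linarith)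
    calc (N : ℝ) * ρ j ^ (1 - γ) * m ^ max α β
        ≤ N * (C₁ ^ (1 - γ) * (N : ℝ)⁻¹) * 1 := by gcongr
      _ = C₁ ^ (1 - γ) * 1 := by field_simp
      _ ≤ C₁ ^ (1 - γ) * ((64 : ℕ) : ℝ) := by gcongr; norm_num
  · have h1 : (c₁ * 3 ^ (-(1 / q))) ^ (γ' - γ) * (N : ℝ) ^ (-((γ' - γ) / (1 - γ)))
        ≤ ρ j ^ (γ' - γ) := by
      rw [← hpow, ← Real.mul_rpow (by positivity) (by positivity)]
      exact Real.rpow_le_rpow (by positivity) hlo (by linarith)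
    calc _ = c * ((c₁ * 3 ^ (-(1 / q))) ^ (γ' - γ) * (N : ℝ) ^ (-((γ' - γ) / (1 - γ))))
          * m ^ (max α β - β') := by ring
      _ ≤ _ := by gcongr

end Main

end OperatorLearning

end

/-- Information theoretic lower bound. The constant `c` does not depend on the sample size, on the
estimator, or on the data distribution that is found. Estimators may take arbitrary possibly
unbounded linear operators as values. -/
theorem theorem1
    {HK HL : Type*}
    [NormedAddCommGroup HK] [InnerProductSpace ℝ HK] [CompleteSpace HK]
    [MeasurableSpace HK] [BorelSpace HK]
    [NormedAddCommGroup HL] [InnerProductSpace ℝ HL] [CompleteSpace HL]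
    [MeasurableSpace HL] [BorelSpace HL]
    (PK : Measure HK) [IsProbabilityMeasure PK] (QL : Measure HL) [IsProbabilityMeasure QL]
    (e : HilbertBasis ℕ ℝ HK) (μ : ℕ → ℝ) (f : HilbertBasis ℕ ℝ HL) (ρ : ℕ → ℝ)
    (hμ : OperatorLearning.IsEigenSystem PK e μ) (hρ : OperatorLearning.IsEigenSystem QL f ρ)
    (p q α β γ β' γ' A₁ : ℝ)
    (hp : 0 < p ∧ p < 1) (hq : 0 < q ∧ q < 1)
    (hμp : OperatorLearning.PolynomialDecay μ p) (hρq : OperatorLearning.PolynomialDecay ρ q)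
    (hα : 0 < α ∧ α < 1) (hemb : OperatorLearning.InputEmbedding PK e μ α A₁)
    (hβ' : 0 ≤ β') (hβ'β : β' < β) (hβ : β ≤ 1)
    (hγ : 0 ≤ γ) (hγγ' : γ < γ') (hγ' : γ' ≤ 1)
    (A₂ σ R B : ℝ) (hA₂ : 0 < A₂) (hσ : 0 < σ) (hR : 0 < R) (hB : 0 < B) :
    ∃ c : ℝ, 0 < c ∧
      ∀ N : ℕ, 1 ≤ N → ∀ estimator : (Fin N → HK × HL) → (HK →ₗ.[ℝ] HL),
        ∃ (A₀ : HK →L[ℝ] HL) (PKL : Measure (HK × HL)) (κ : Kernel HK HL),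
          OperatorLearning.IsDataModel PK PKL κ A₀ ∧
          OperatorLearning.OutputBounded PK A₀ A₂ ∧
          OperatorLearning.MomentCondition PK κ A₀ f σ R ∧
          OperatorLearning.SourceCondition e μ f ρ β γ A₀ B ∧
          ENNReal.ofReal 0.99 ≤ Measure.pi (fun _ : Fin N => PKL)
            {D | ENNReal.ofReal
                (c * (N : ℝ) ^ (-(min ((max α β - β') / (max α β + p)) ((γ' - γ) / (1 - γ)))))
              ≤ OperatorLearning.bgNormSq e μ f ρ β' γ'
                (estimator D - OperatorLearning.ofCLM A₀)} := by
  obtain ⟨Cρ, hρC⟩ := hρq.exists_le hq.1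
  -- The case split depends only on the fixed parameters, so `c` may depend on it.
  rcases min_choice ((max α β - β') / (max α β + p)) ((γ' - γ) / (1 - γ)) with h | h
  · rw [h]
    exact OperatorLearning.exists_hasHardInstance_input PK e f hμ hp.1 hμp hρq.pos hρC hα.1 hα.2.le
      hemb hβ (hγγ'.le.trans hγ') hβ'β hγ' hA₂ hσ hR hB
  · rw [h]
    exact OperatorLearning.exists_hasHardInstance_output PK e f hμ hp.1 hμp hq.1 hρq hα.1 hα.2.le
      hemb hβ (hβ'β.le.trans hβ) hγγ' hγ' hA₂ hσ hR hB
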